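/- Let $n,N\in\mathbb N_0$, $p\in(1,\infty)$, $\mu\in\mathbb R$. Write $\langle\xi\rangle=(1+|\xi|^2)^{1/2}$ and let $a=(a_{ij})\in S^\mu(\mathbb R^n;\mathbb C^{N\times N})$, i.e. every entry $a_{ij}\in C^\infty(\mathbb R^n)$ and for every multi-index $\alpha$ there is $C_\alpha>0$ with $|\partial^\alpha a_{ij}(\xi)|\le C_\alpha\langle\xi\rangle^{\mu-|\alpha|}$ for all $\xi\in\mathbb R^n$. Assume that $a$ is quasi-hyperbolic: there is $M\in\mathbb R$ such that $\det(\lambda-a(\xi))\neq0$ for all $\lambda\in\mathbb C$ with $\operatorname{Re}\lambda>M$ and all $\xi\in\mathbb R^n$. Let $\mathscr F\phi(\xi)=(2\pi)^{-n/2}\int_{\mathbb R^n}e^{ix\cdot\xi}\phi(x)\,dx$ on $\mathscr S(\mathbb R^n;\mathbb C^N)$, extended by duality to the tempered distributions $\mathscr S'(\mathbb R^n;\mathbb C^N)$, and let $\operatorname{op}[a]=\mathscr F^{-1}a\mathscr F$ on $\mathscr S'(\mathbb R^n;\mathbb C^N)$. In $X=L^p(\mathbb R^n;\mathbb C^N)\subset\mathscr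 S'(\mathbb R^n;\mathbb C^N)$ define the unbounded operator $A u=\operatorname{op}[a]u$ with maximal domain $D(A)=\{u\in X:\operatorname{op}[a]u\in X\}$. A function $m\in L^\infty(\mathbb R^n;\mathbb C^{N\times N})$ is an $L^p$-Fourier multiplier if there is $c>0$ such that $\operatorname{op}[m]\phi:=\mathscr F^{-1}m\mathscr F\phi\in X$ and $\|\operatorname{op}[m]\phi\|_{X}\le c\|\phi\|_{X}$ for all $\phi\in\mathscr S(\mathbb R^n;\mathbb C^N)$. Then $\operatorname{op}[m]$ also denotes the extension by continuity to a bounded operator on $X$, and $\|m\|_{M_p^N}$ is the operator norm of this extension. The Cauchy problem $\partial_tu-Au=0$ $(t>0)$, $u(0)=u_0$, for a closed densely defined operator $A$ in $X$ is called well-posed if for every $u_0\in D(A)$ there is a unique classical solution $u$, that is, a unique $u\in C^1([0,\infty),X)$ with $u(t)\in D(A)$ and $\partial_tu(t)=Au(t)$ for $t>0$ and $u(0)=u_0$, and if for all $T>0$ there is $C_T>0$ such that for all $u_0\in D(A)$ this solution satisfies $\|u(t)\|_X\le C_T\|u_0\|_X$ for $t\in[0,T]$. **Theorem.** The operator $A$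 is closed and densely defined, and the following holds. The Cauchy problem for $A$ is well-posed if and only if for all $T>0$ there is $C_T>0$ such that, for all $t\in[0,T]$, $e^{ta(\cdot)}$ is an $L^p$-Fourier multiplier and $$\big\|e^{ta(\cdot)}\big\|_{M_p^N}\le C_T .$$ In this case $e^{ta(\cdot)}$ is an $L^p$-Fourier multiplier for every $t\ge0$, the family $(\operatorname{op}[e^{ta(\cdot)}])_{t\ge0}$ is a $C_0$-semigroup on $X$, and its generator is $A$. -/

import Mathlib

open MeasureTheory Filter Topology
open scoped ENNReal NNReal ContDiff SchwartzMap FourierTransform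

noncomputable section

/-! ### Symbols -/

/-- The Hörmander class `S^μ(ℝⁿ) = S^μ_{1,0}(ℝⁿ)` of `x`-independent scalar symbols of order `μ`:
smooth functions all of whose derivatives of order `k` are bounded by a constant times
`⟨ξ⟩^(μ - k)`, with `⟨ξ⟩ = (1 + |ξ|²)^(1/2)`. (The norm of the `k`-th Fréchet derivative at `ξ` is
comparable, uniformly in `ξ`, to the largest of the numbers `|∂^α b(ξ)|` with `|α| = k`.) -/
def IsScalarSymbol {n : ℕ} (μ : ℝ) (b : EuclideanSpace ℝ (Fin n) → ℂ) : Prop :=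
  ContDiff ℝ ∞ b ∧ ∀ k : ℕ, ∃ C : ℝ, 0 < C ∧ ∀ ξ : EuclideanSpace ℝ (Fin n),
    ‖iteratedFDeriv ℝ k b ξ‖ ≤ C * (√(1 + ‖ξ‖ ^ 2)) ^ (μ - (k : ℝ))

/-- The class `S^μ(ℝⁿ; ℂ^{N×N})` of matrix-valued symbols. -/
def IsMatrixSymbol {n N : ℕ} (μ : ℝ)
    (a : EuclideanSpace ℝ (Fin n) → Matrix (Fin N) (Fin N) ℂ) : Prop :=
  ∀ i j, IsScalarSymbol μ (fun ξ => a ξ i j)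

/-- Quasi-hyperbolicity (correctness in the sense of Petrovskiĭ): for some `M ∈ ℝ`,
`det(λ - a(ξ)) ≠ 0` whenever `Re λ > M` and `ξ ∈ ℝⁿ`. -/
def IsQuasiHyperbolic {n N : ℕ}
    (a : EuclideanSpace ℝ (Fin n) → Matrix (Fin N) (Fin N) ℂ) : Prop :=
  ∃ M : ℝ, ∀ z : ℂ, M < z.re → ∀ ξ : EuclideanSpace ℝ (Fin n),
    (z • (1 : Matrix (Fin N) (Fin N) ℂ) - a ξ).det ≠ 0

/-- The symbol `e^{t a(·)}` (pointwise matrix exponential). -/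
def expSymbol {n N : ℕ} (a : EuclideanSpace ℝ (Fin n) → Matrix (Fin N) (Fin N) ℂ) (t : ℝ) :
    EuclideanSpace ℝ (Fin n) → Matrix (Fin N) (Fin N) ℂ :=
  fun ξ => NormedSpace.exp (t • a ξ)

/-! ### Fourier multiplier operators

The Fourier transform used here is `(ℱφ)(ξ) = (2π)^(-n/2) ∫ e^{i x·ξ} φ(x) dx`. In terms of
Mathlib's `𝓕 φ(ξ) = ∫ e^{-2πi x·ξ} φ(x) dx` it is `(ℱφ)(ξ) = (2π)^(-n/2) (𝓕 φ)(-ξ/(2π))`, so that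
`ℱ⁻¹ m ℱ = 𝓕⁻ m(-2π ·) 𝓕`, on functions as well as on tempered distributions. -/

/-- `op[m] φ = ℱ⁻¹ m ℱ φ` for a Schwartz function `φ` with values in `ℂᴺ` and a bounded measurable
matrix-valued function `m`. -/
def opSchwartz {n N : ℕ} (m : EuclideanSpace ℝ (Fin n) → Matrix (Fin N) (Fin N) ℂ)
    (φ : 𝓢(EuclideanSpace ℝ (Fin n), EuclideanSpace ℂ (Fin N))) :
    EuclideanSpace ℝ (Fin n) → EuclideanSpace ℂ (Fin N) :=
  𝓕⁻ (fun ξ : EuclideanSpace ℝ (Fin n) =>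
    Matrix.toEuclideanCLM (n := Fin N) (𝕜 := ℂ) (m (-(2 * Real.pi) • ξ)) (𝓕 φ ξ))

/-- `opSchwartz` is `ℱ⁻¹ m ℱ` for the Fourier transform with kernel `(2π)^(-n/2) e^{i x·ξ}`. -/
theorem opSchwartz_eq_integral {n N : ℕ}
    (m : EuclideanSpace ℝ (Fin n) → Matrix (Fin N) (Fin N) ℂ)
    (φ : 𝓢(EuclideanSpace ℝ (Fin n), EuclideanSpace ℂ (Fin N))) (x : EuclideanSpace ℝ (Fin n)) :
    opSchwartz m φ x =
      ((2 * Real.pi) ^ (-(n : ℝ) / 2) : ℝ) • ∫ ξ : EuclideanSpace ℝ (Fin n),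
        Complex.exp (-Complex.I * (inner ℝ x ξ : ℝ)) •
          Matrix.toEuclideanCLM (n := Fin N) (𝕜 := ℂ) (m ξ)
            (((2 * Real.pi) ^ (-(n : ℝ) / 2) : ℝ) • ∫ y : EuclideanSpace ℝ (Fin n),
              Complex.exp (Complex.I * (inner ℝ y ξ : ℝ)) • φ y) := by
  have hpi : (0 : ℝ) < 2 * Real.pi := by positivity
  have key := Measure.integral_comp_smul (volume : Measure (EuclideanSpace ℝ (Fin n)))
    (fun ξ : EuclideanSpace ℝ (Fin n) =>
        Complex.exp (-Complex.I * (inner ℝ x ξ : ℝ)) •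
          Matrix.toEuclideanCLM (n := Fin N) (𝕜 := ℂ) (m ξ)
            (∫ y : EuclideanSpace ℝ (Fin n),
              Complex.exp (Complex.I * (inner ℝ y ξ : ℝ)) • φ y)) (-(2 * Real.pi))
  have h1 : |((-(2 * Real.pi)) ^ n)⁻¹| =
      (2 * Real.pi) ^ (-(n : ℝ) / 2) * (2 * Real.pi) ^ (-(n : ℝ) / 2) := by
    rw [abs_inv, abs_pow, abs_neg, abs_of_pos hpi, ← Real.rpow_add hpi,
      show -(n : ℝ) / 2 + -(n : ℝ) / 2 = -(n : ℝ) by ring, Real.rpow_neg hpi.le,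
      Real.rpow_natCast]
  simp only [finrank_euclideanSpace, Fintype.card_fin, h1] at key
  have hs : ∀ (T : EuclideanSpace ℂ (Fin N) →L[ℂ] EuclideanSpace ℂ (Fin N)) (r : ℝ)
      (v : EuclideanSpace ℂ (Fin N)), T (r • v) = r • T v := fun T r v => by
    rw [← Complex.coe_smul, map_smul, Complex.coe_smul]
  have hc : ∀ (z : ℂ) (r : ℝ) (v : EuclideanSpace ℂ (Fin N)), z • r • v = r • z • v :=
    fun z r v => smul_comm z r v
  simp only [hs, hc, integral_smul]
  rw [smul_smul, ← key, opSchwartz, Real.fourierInv_eq']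
  refine integral_congr_ae (ae_of_all _ fun ξ => ?_)
  simp only [SchwartzMap.fourier_coe, Real.fourier_eq', real_inner_smul_right]
  rw [real_inner_comm x ξ]
  have e1 : ((2 * Real.pi * inner ℝ x ξ : ℝ) : ℂ) * Complex.I =
      -Complex.I * ((-(2 * Real.pi) * inner ℝ x ξ : ℝ) : ℂ) := by push_cast; ring
  have e2 : ∀ y : EuclideanSpace ℝ (Fin n), ((-2 * Real.pi * inner ℝ y ξ : ℝ) : ℂ) * Complex.I =
      Complex.I * ((-(2 * Real.pi) * inner ℝ y ξ : ℝ) : ℂ) := fun y => by push_cast; ring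
  simp only [e1, e2]

/-- `op[a]` on the space `𝓢'(ℝⁿ; ℂᴺ)` of tempered distributions, for a symbol `a` with entries
that are smooth and slowly increasing together with all derivatives:
`(op[a] u)_i = ∑_j ℱ⁻¹ a_{ij} ℱ u_j`. Composition with `Matrix.single i j 1` moves the `j`-th
component to the `i`-th place and deletes the others. -/
def opDistribution {n N : ℕ} (a : EuclideanSpace ℝ (Fin n) → Matrix (Fin N) (Fin N) ℂ) :
    𝓢'(EuclideanSpace ℝ (Fin n), EuclideanSpace ℂ (Fin N)) →L[ℂ]
      𝓢'(EuclideanSpace ℝ (Fin n), EuclideanSpace ℂ (Fin N)) :=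
  ∑ i, ∑ j,
    (PointwiseConvergenceCLM.postcomp 𝓢(EuclideanSpace ℝ (Fin n), ℂ)
      (Matrix.toEuclideanCLM (n := Fin N) (𝕜 := ℂ) (Matrix.single i j 1))) ∘L
    TemperedDistribution.fourierMultiplierCLM (EuclideanSpace ℂ (Fin N))
      (fun ξ => a (-(2 * Real.pi) • ξ) i j)

theorem opDistribution_apply {n N : ℕ}
    (a : EuclideanSpace ℝ (Fin n) → Matrix (Fin N) (Fin N) ℂ)
    (u : 𝓢'(EuclideanSpace ℝ (Fin n), EuclideanSpace ℂ (Fin N)))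
    (φ : 𝓢(EuclideanSpace ℝ (Fin n), ℂ)) (i : Fin N) :
    (opDistribution a u φ) i = ∑ j, (u (𝓕 (SchwartzMap.smulLeftCLM ℂ
      (fun ξ => a (-(2 * Real.pi) • ξ) i j) (𝓕⁻ φ)))) j := by
  have hsum : ∀ f : Fin N → 𝓢'(EuclideanSpace ℝ (Fin n), EuclideanSpace ℂ (Fin N)),
      (∑ k, f k) φ = ∑ k, f k φ := fun f =>
    map_sum (AddMonoidHom.mk' (fun v : 𝓢'(EuclideanSpace ℝ (Fin n), EuclideanSpace ℂ (Fin N)) =>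
      v φ) fun _ _ => rfl) f Finset.univ
  simp only [opDistribution, sum_apply, hsum, WithLp.ofLp_sum, Finset.sum_apply,
    ContinuousLinearMap.comp_apply]
  rw [Finset.sum_eq_single i]
  · refine Finset.sum_congr rfl fun j _ => ?_
    change (Matrix.single i j (1 : ℂ)).mulVec _ i = _
    simp only [Matrix.single_mulVec, one_mul, Function.update_self]
    rfl
  · intro k _ hk
    refine Finset.sum_eq_zero fun j _ => ?_
    change (Matrix.single k j (1 : ℂ)).mulVec _ i = _
    simp [Matrix.single_mulVec, Function.update_of_ne hk.symm]
  · simp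

/-! ### The maximal realization of `op[a]` in `L^p` -/

/-- The space `L^p(ℝⁿ; ℂᴺ)`. -/
abbrev LpSpace (n N : ℕ) (p : ℝ≥0∞) : Type :=
  Lp (EuclideanSpace ℂ (Fin N)) p (volume : Measure (EuclideanSpace ℝ (Fin n)))

/-- The embedding `L^p(ℝⁿ; ℂᴺ) ⊆ 𝓢'(ℝⁿ; ℂᴺ)`. -/
def lpEmb (n N : ℕ) (p : ℝ≥0∞) [Fact (1 ≤ p)] :
    LpSpace n N p →ₗ[ℂ] 𝓢'(EuclideanSpace ℝ (Fin n), EuclideanSpace ℂ (Fin N)) :=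
  (Lp.toTemperedDistributionCLM (EuclideanSpace ℂ (Fin N))
    (volume : Measure (EuclideanSpace ℝ (Fin n))) p).toLinearMap

theorem lpEmb_injective (n N : ℕ) (p : ℝ≥0∞) [Fact (1 ≤ p)] :
    Function.Injective (lpEmb n N p) :=
  LinearMap.ker_eq_bot.mp Lp.ker_toTemperedDistributionCLM_eq_bot

/-- The maximal domain `{u ∈ L^p : op[a] u ∈ L^p}`. -/
def maximalDomain {n N : ℕ} (p : ℝ≥0∞) [Fact (1 ≤ p)]
    (a : EuclideanSpace ℝ (Fin n) → Matrix (Fin N) (Fin N) ℂ) : Submodule ℂ (LpSpace n N p) :=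
  (LinearMap.range (lpEmb n N p)).comap ((opDistribution a).toLinearMap ∘ₗ lpEmb n N p)

/-- The unbounded operator `A = op[a]` in `L^p(ℝⁿ; ℂᴺ)` with maximal domain: `A u` is the unique
element of `L^p` that represents the tempered distribution `op[a] u`. -/
def maximalRealization {n N : ℕ} (p : ℝ≥0∞) [Fact (1 ≤ p)]
    (a : EuclideanSpace ℝ (Fin n) → Matrix (Fin N) (Fin N) ℂ) :
    LpSpace n N p →ₗ.[ℂ] LpSpace n N p where
  domain := maximalDomain p a
  toFun := (LinearEquiv.ofInjective (lpEmb n N p) (lpEmb_injective n N p)).symm.toLinearMap ∘ₗ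
    LinearMap.restrict ((opDistribution a).toLinearMap ∘ₗ lpEmb n N p)
      (p := maximalDomain p a) (q := LinearMap.range (lpEmb n N p)) (fun _ hu => hu)

theorem lpEmb_maximalRealization {n N : ℕ} (p : ℝ≥0∞) [Fact (1 ≤ p)]
    (a : EuclideanSpace ℝ (Fin n) → Matrix (Fin N) (Fin N) ℂ)
    (u : (maximalRealization p a).domain) :
    lpEmb n N p (maximalRealization p a u) = opDistribution a (lpEmb n N p u) :=
  congrArg Subtype.val
    ((LinearEquiv.ofInjective (lpEmb n N p) (lpEmb_injective n N p)).apply_symm_apply _)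

/-! ### `L^p`-Fourier multipliers -/

/-- `m ∈ L^∞(ℝⁿ; ℂ^{N×N})` is an `L^p`-Fourier multiplier: there is `c > 0` with `op[m] φ ∈ L^p` and
`‖op[m] φ‖_p ≤ c ‖φ‖_p` for all Schwartz functions `φ`. -/
structure IsLpFourierMultiplier {n N : ℕ} (p : ℝ≥0∞)
    (m : EuclideanSpace ℝ (Fin n) → Matrix (Fin N) (Fin N) ℂ) : Prop where
  memLp_top : ∀ i j, MemLp (fun ξ => m ξ i j) ⊤ volume
  memLp_op : ∀ φ : 𝓢(EuclideanSpace ℝ (Fin n), EuclideanSpace ℂ (Fin N)),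
    MemLp (opSchwartz m φ) p volume
  bound : ∃ c : ℝ, 0 < c ∧ ∀ φ : 𝓢(EuclideanSpace ℝ (Fin n), EuclideanSpace ℂ (Fin N)),
    eLpNorm (opSchwartz m φ) p volume ≤ ENNReal.ofReal c * eLpNorm φ p volume

theorem integrable_symbol_mul_fourier {n N : ℕ}
    {m : EuclideanSpace ℝ (Fin n) → Matrix (Fin N) (Fin N) ℂ}
    (hm : ∀ i j, MemLp (fun ξ => m ξ i j) ⊤ volume)
    (φ : 𝓢(EuclideanSpace ℝ (Fin n), EuclideanSpace ℂ (Fin N))) :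
    Integrable (fun ξ : EuclideanSpace ℝ (Fin n) =>
      Matrix.toEuclideanCLM (n := Fin N) (𝕜 := ℂ) (m (-(2 * Real.pi) • ξ)) (𝓕 φ ξ)) := by
  have hpi : -(2 * Real.pi) ≠ 0 := by simp [Real.pi_ne_zero]
  have hq : Measure.QuasiMeasurePreserving
      (fun ξ : EuclideanSpace ℝ (Fin n) => (-(2 * Real.pi)) • ξ) volume volume := by
    refine ⟨measurable_const_smul _, ?_⟩
    rw [Measure.map_addHaar_smul _ hpi]
    exact Measure.smul_absolutelyContinuous
  have key : ∀ i j, Integrable (fun ξ : EuclideanSpace ℝ (Fin n) =>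
      m (-(2 * Real.pi) • ξ) i j •
        Matrix.toEuclideanCLM (n := Fin N) (𝕜 := ℂ) (Matrix.single i j 1) (𝓕 φ ξ)) := by
    intro i j
    have hint : Integrable (fun ξ : EuclideanSpace ℝ (Fin n) =>
        Matrix.toEuclideanCLM (n := Fin N) (𝕜 := ℂ) (Matrix.single i j 1) (𝓕 φ ξ)) :=
      (Matrix.toEuclideanCLM (n := Fin N) (𝕜 := ℂ) (Matrix.single i j 1)).integrable_comp
        ((𝓕 φ).integrable (μ := volume))
    refine hint.smul_of_top_right (φ := fun ξ => m (-(2 * Real.pi) • ξ) i j) ?_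
    refine ⟨(hm i j).1.comp_quasiMeasurePreserving hq, ?_⟩
    rw [eLpNorm_exponent_top]
    refine lt_of_le_of_lt (eLpNormEssSup_le_of_ae_enorm_bound (hq.ae ae_le_eLpNormEssSup))
      (b := eLpNormEssSup (fun ξ => m ξ i j) volume) ?_
    simpa using (hm i j).2
  have hsum := integrable_finsetSum Finset.univ fun i _ =>
    integrable_finsetSum Finset.univ fun j _ => key i j
  refine hsum.congr (ae_of_all _ fun ξ => ?_)
  dsimp only
  conv_rhs => rw [Matrix.matrix_eq_sum_single (m (-(2 * Real.pi) • ξ))]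
  simp only [map_sum, sum_apply]
  refine Finset.sum_congr rfl fun i _ => Finset.sum_congr rfl fun j _ => ?_
  rw [← smul_apply, ← map_smul, Matrix.smul_single, smul_eq_mul, mul_one]

/-- `op[m]` as a linear map from Schwartz functions to `L^p`. -/
def IsLpFourierMultiplier.opLinear {n N : ℕ} {p : ℝ≥0∞} [Fact (1 ≤ p)]
    {m : EuclideanSpace ℝ (Fin n) → Matrix (Fin N) (Fin N) ℂ} (hm : IsLpFourierMultiplier p m) :
    𝓢(EuclideanSpace ℝ (Fin n), EuclideanSpace ℂ (Fin N)) →ₗ[ℂ] LpSpace n N p where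
  toFun φ := (hm.memLp_op φ).toLp
  map_add' φ ψ := by
    rw [← MemLp.toLp_add]
    congr 1
    ext1 x
    simp only [opSchwartz, Pi.add_apply, Real.fourierInv_eq, FourierTransform.fourier_add,
      add_apply, map_add, smul_add]
    have aux := fun χ => (Real.fourierIntegral_convergent_iff (-x)).2
      (integrable_symbol_mul_fourier hm.memLp_top χ)
    simp only [inner_neg_right, neg_neg] at aux
    exact integral_add (aux φ) (aux ψ)
  map_smul' c φ := by
    rw [RingHom.id_apply, ← MemLp.toLp_const_smul]
    congr 1
    ext1 x
    simp only [opSchwartz, Pi.smul_apply, Real.fourierInv_eq, FourierTransform.fourier_smul,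
      smul_apply, map_smul, smul_comm _ c]
    exact integral_smul c _

/-- `op[m] ∈ L(L^p(ℝⁿ; ℂᴺ))`: the extension by continuity from the Schwartz functions. Its operator
norm is the multiplier norm of `m`. -/
def IsLpFourierMultiplier.op {n N : ℕ} {p : ℝ≥0∞} [Fact (1 ≤ p)]
    {m : EuclideanSpace ℝ (Fin n) → Matrix (Fin N) (Fin N) ℂ} (hm : IsLpFourierMultiplier p m) :
    LpSpace n N p →L[ℂ] LpSpace n N p :=
  hm.opLinear.extendOfNorm (SchwartzMap.toLpCLM ℂ (EuclideanSpace ℂ (Fin N)) p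
    (volume : Measure (EuclideanSpace ℝ (Fin n)))).toLinearMap

theorem IsLpFourierMultiplier.op_toLp {n N : ℕ} {p : ℝ≥0∞} [Fact (1 ≤ p)] (hp : p ≠ ⊤)
    {m : EuclideanSpace ℝ (Fin n) → Matrix (Fin N) (Fin N) ℂ} (hm : IsLpFourierMultiplier p m)
    (φ : 𝓢(EuclideanSpace ℝ (Fin n), EuclideanSpace ℂ (Fin N))) :
    hm.op (φ.toLp p) = (hm.memLp_op φ).toLp := by
  have hb : ∃ C, ∀ ψ, ‖hm.opLinear ψ‖ ≤ C * ‖(SchwartzMap.toLpCLM ℂ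
      (EuclideanSpace ℂ (Fin N)) p (volume : Measure (EuclideanSpace ℝ (Fin n)))).toLinearMap ψ‖ := by
    obtain ⟨c, hc, h⟩ := hm.bound
    refine ⟨c, fun ψ => ?_⟩
    have h1 : ‖hm.opLinear ψ‖ = (eLpNorm (opSchwartz m ψ) p volume).toReal :=
      Lp.norm_toLp _ (hm.memLp_op ψ)
    have h2 : ‖(SchwartzMap.toLpCLM ℂ (EuclideanSpace ℂ (Fin N)) p
        (volume : Measure (EuclideanSpace ℝ (Fin n)))).toLinearMap ψ‖ =
        (eLpNorm ψ p volume).toReal := SchwartzMap.norm_toLp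
    rw [h1, h2]
    have h3 := ENNReal.toReal_mono
      (ENNReal.mul_ne_top ENNReal.ofReal_ne_top (ψ.memLp p volume).2.ne) (h ψ)
    rwa [ENNReal.toReal_mul, ENNReal.toReal_ofReal hc.le] at h3
  have hd : DenseRange (SchwartzMap.toLpCLM ℂ (EuclideanSpace ℂ (Fin N)) p
      (volume : Measure (EuclideanSpace ℝ (Fin n)))).toLinearMap :=
    SchwartzMap.denseRange_toLpCLM (F := EuclideanSpace ℂ (Fin N)) hp
  exact LinearMap.extendOfNorm_eq hd hb φ

/-- The multiplier norm `‖m‖_{M_p^N}`, the operator norm of `op[m]` in `L(L^p(ℝⁿ; ℂᴺ))`. -/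
def IsLpFourierMultiplier.multiplierNorm {n N : ℕ} {p : ℝ≥0∞} [Fact (1 ≤ p)]
    {m : EuclideanSpace ℝ (Fin n) → Matrix (Fin N) (Fin N) ℂ} (hm : IsLpFourierMultiplier p m) :
    ℝ :=
  ‖hm.op‖

/-! ### Abstract Cauchy problems -/

section Cauchy

variable {X : Type*} [NormedAddCommGroup X] [NormedSpace ℂ X]

/-- `u` (restricted to `[0,∞)`) is a classical solution of `∂ₜ u = A u` for `t > 0`, `u(0) = u₀`:
`u ∈ C¹([0,∞), X)` and `u(t) ∈ D(A)` for `t > 0`. -/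
structure IsClassicalSolution (A : X →ₗ.[ℂ] X) (u₀ : X) (u : ℝ → X) : Prop where
  contDiffOn : ContDiffOn ℝ 1 u (Set.Ici 0)
  initial : u 0 = u₀
  equation : ∀ t : ℝ, 0 < t → ∃ h : u t ∈ A.domain, HasDerivAt u (A ⟨u t, h⟩) t

/-- Well-posedness of the Cauchy problem `∂ₜ u = A u` (`t > 0`), `u(0) = u₀`, for a closed densely
defined operator `A`: for each `u₀ ∈ D(A)` there is a unique classical solution, and on compact
time intervals it is bounded by a constant times `‖u₀‖`. -/
structure IsWellPosed (A : X →ₗ.[ℂ] X) : Prop where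
  exists_solution : ∀ u₀ ∈ A.domain, ∃ u : ℝ → X, IsClassicalSolution A u₀ u
  unique_solution : ∀ u₀ ∈ A.domain, ∀ u v : ℝ → X,
    IsClassicalSolution A u₀ u → IsClassicalSolution A u₀ v → Set.EqOn u v (Set.Ici 0)
  bound : ∀ T : ℝ, 0 < T → ∃ C : ℝ, 0 < C ∧ ∀ u₀ ∈ A.domain, ∀ u : ℝ → X,
    IsClassicalSolution A u₀ u → ∀ t ∈ Set.Icc 0 T, ‖u t‖ ≤ C * ‖u₀‖

/-- `C₀`-semigroups on `X`. -/
structure IsC0Semigroup (S : ℝ≥0 → X →L[ℂ] X) : Prop where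
  map_zero : S 0 = ContinuousLinearMap.id ℂ X
  map_add : ∀ s t : ℝ≥0, S (s + t) = S s ∘L S t
  continuous_orbit : ∀ x : X, Continuous fun t => S t x

/-- `A` is the generator of `S`: `x ∈ D(A)` and `A x = y` if and only if
`(S(h) x - x) / h → y` as `h → 0+`. -/
def IsGeneratorOf (A : X →ₗ.[ℂ] X) (S : ℝ≥0 → X →L[ℂ] X) : Prop :=
  ∀ x y : X, (x, y) ∈ A.graph ↔
    Tendsto (fun h : ℝ≥0 => (h : ℝ)⁻¹ • (S h x - x)) (𝓝[>] 0) (𝓝 y)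

end Cauchy

end

noncomputable section

/-! ### Smooth families of compactly supported functions -/

section SmoothFamilies

variable {E V W : Type*} [NormedAddCommGroup E] [NormedSpace ℝ E]
  [NormedAddCommGroup V] [NormedSpace ℝ V]

/-! On the Fourier side the Cauchy problem is the linear ODE `∂ₜû = a û` at each frequency, so the
only possible solution is `û(t) = e^{ta} û₀`, and well-posedness is a question of `L^p` bounds for
`e^{ta}`. To argue this way without controlling `e^{ta}` at infinity, the equation `v̂ = m û`
between `L^p` functions is tested only against smooth compactly supported `χ` (`IsFourierRelated`).
This makes sense for every smooth `m`, determines `v`, is closed in `(u, v)` and is compatible with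
products of symbols; for `m = a` it describes the graph of `A` (`mem_graph_iff_isFourierRelated`).
Since `s ↦ e^{sa} χ` is a differentiable curve of test functions (`hasDerivAt_compactSchwartz`),
calculus in `s` is available.

If the problem is well-posed, differentiating `e^{(t-s)a} û(s)` identifies every classical solution
(`IsClassicalSolution.isFourierRelated`), and the a priori estimate bounds `op[e^{ta}]` on functions
whose Fourier transform is smooth with compact support. Blowing up around a frequency `ξ₀` turns
this into a pointwise bound of the matrix `e^{ta(ξ₀)}` (`HasCompactFourierBound.norm_le`), so the
symbol is in `L^∞`; approximation and Fatou's lemma extend the `L^p` bound to all Schwartz functions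
(`HasCompactFourierBound.eLpNorm_opSchwartz_le`).

Conversely, let `S(t) = op[e^{ta}]` be bounded locally uniformly in `t`. The semigroup law follows
from `e^{(s+t)a} = e^{sa} e^{ta}`, and strong continuity from continuity on a dense set. The
identity `S(t)u = u + ∫₀ᵗ S(s)Au ds` (`orbit_eq_add_integral`) gives the classical solutions and one
half of the description of the generator; the other half is a passage to the limit in the tested
equation. -/

theorem iteratedFDeriv_slice {g : ℝ × E → V} (hg : ContDiff ℝ ∞ g) (l : ℕ) (s : ℝ) (x : E) :
    iteratedFDeriv ℝ l (fun y => g (s, y)) x =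
      (iteratedFDeriv ℝ l g (s, x)).compContinuousLinearMap
        fun _ => ContinuousLinearMap.inr ℝ ℝ E := by
  have h1 : (fun y => g (s, y)) =
      (fun z : ℝ × E => g ((s, 0) + z)) ∘ ContinuousLinearMap.inr ℝ ℝ E := by
    ext y; simp
  have h2 : ContDiff ℝ ∞ (fun z : ℝ × E => g ((s, 0) + z)) := by fun_prop
  rw [h1, ContinuousLinearMap.iteratedFDeriv_comp_right _ h2 x (mod_cast le_top),
    iteratedFDeriv_comp_add_left]
  simp

theorem contDiff_iteratedFDeriv_slice {g : ℝ × E → V} (hg : ContDiff ℝ ∞ g) (l : ℕ) :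
    ContDiff ℝ ∞ (fun z : ℝ × E => iteratedFDeriv ℝ l (fun y => g (z.1, y)) z.2) := by
  have h : (fun z : ℝ × E => iteratedFDeriv ℝ l (fun y => g (z.1, y)) z.2) =
      fun z => ContinuousMultilinearMap.compContinuousLinearMapL
        (fun _ : Fin l => ContinuousLinearMap.inr ℝ ℝ E) (iteratedFDeriv ℝ l g z) := by
    ext1 z
    exact iteratedFDeriv_slice hg l z.1 z.2
  rw [h]
  exact (ContinuousLinearMap.contDiff _).comp (hg.iteratedFDeriv_right (m := ∞) le_rfl)

/-- Induction on the order: split off the last argument of the iterated derivative and move `e` past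
it by symmetry of the second derivative. -/
theorem fderiv_iteratedFDeriv_apply {Z : Type*} [NormedAddCommGroup Z] [NormedSpace ℝ Z] {l : ℕ}
    {f : Z → V} (hf : ContDiff ℝ ∞ f) (z e : Z) (v : Fin l → Z) :
    fderiv ℝ (iteratedFDeriv ℝ l f) z e v = iteratedFDeriv ℝ l (fun y => fderiv ℝ f y e) z v := by
  have hd : ∀ {h : Z → V} (k : ℕ), ContDiff ℝ ∞ h → Differentiable ℝ (iteratedFDeriv ℝ k h) :=
    fun k hh => (hh.iteratedFDeriv_right (m := ∞) (i := k) le_rfl).differentiable (by simp)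
  have happ : ∀ {h : Z → V} (k : ℕ), ContDiff ℝ ∞ h → ∀ (y : Z) (u : Fin k → Z),
      fderiv ℝ (fun y => iteratedFDeriv ℝ k h y u) y e = fderiv ℝ (iteratedFDeriv ℝ k h) y e u := by
    intro h k hh y u
    have := ((ContinuousMultilinearMap.apply ℝ (fun _ : Fin k => Z) V u).hasFDerivAt.comp y
      (hd k hh y).hasFDerivAt).fderiv
    exact congrArg (fun T => T e) this
  induction l generalizing f with
  | zero =>
    rw [← happ 0 hf]
    simp
  | succ l ih =>
    have hf' : ContDiff ℝ ∞ (fderiv ℝ f) := hf.fderiv_right (by simp)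
    have hsm : ∀ w : Z, ContDiff ℝ ∞ (fun y => fderiv ℝ f y w) := fun w => by fun_prop
    have hright : ∀ {h : Z → V}, ContDiff ℝ ∞ h → ∀ y, iteratedFDeriv ℝ (l + 1) h y v =
        iteratedFDeriv ℝ l (fun y => fderiv ℝ h y (v (Fin.last l))) y (Fin.init v) := by
      intro h hh y
      rw [iteratedFDeriv_succ_apply_right]
      exact (iteratedFDeriv_clm_apply_const_apply (hh.fderiv_right (m := ∞) (by simp))
        (mod_cast le_top)).symm
    rw [← happ (l + 1) hf, hright (hsm e)]
    simp only [hright hf]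
    rw [happ l (hsm _), ih (hsm _)]
    congr 2
    ext1 y
    have hsymm := (hf.contDiffAt (x := y)).isSymmSndFDerivAt
      (by
        simp only [minSmoothness_of_isRCLikeNormedField]
        exact WithTop.coe_le_coe.2 (le_top : (2 : ℕ∞) ≤ ⊤))
    have h2 : ∀ w w' : Z, fderiv ℝ (fun y => fderiv ℝ f y w) y w' =
        fderiv ℝ (fderiv ℝ f) y w' w := fun w w' => by
      rw [fderiv_clm_apply (hf'.differentiable (by simp) y) (differentiableAt_const _)]
      simp
    rw [h2, h2, hsymm.eq]

/-- The derivative with respect to the parameter commutes with the iterated derivatives with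
respect to the other variable. -/
theorem fderiv_iteratedFDeriv_slice {g : ℝ × E → V} (hg : ContDiff ℝ ∞ g) (l : ℕ) (s : ℝ) (x : E) :
    fderiv ℝ (fun z : ℝ × E => iteratedFDeriv ℝ l (fun y => g (z.1, y)) z.2) (s, x) (1, 0) =
      iteratedFDeriv ℝ l (fun y => fderiv ℝ g (s, y) (1, 0)) x := by
  have h : (fun z : ℝ × E => iteratedFDeriv ℝ l (fun y => g (z.1, y)) z.2) =
      fun z => ContinuousMultilinearMap.compContinuousLinearMapL
        (fun _ : Fin l => ContinuousLinearMap.inr ℝ ℝ E) (iteratedFDeriv ℝ l g z) := by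
    ext1 z
    exact iteratedFDeriv_slice hg l z.1 z.2
  have hd : Differentiable ℝ (iteratedFDeriv ℝ l g) :=
    (hg.iteratedFDeriv_right (m := ∞) (i := l) le_rfl).differentiable (by simp)
  have hg' : ContDiff ℝ ∞ (fderiv ℝ g) := hg.fderiv_right (by simp)
  have hg1 : ContDiff ℝ ∞ (fun z => fderiv ℝ g z ((1 : ℝ), (0 : E))) := by fun_prop
  rw [h, iteratedFDeriv_slice hg1 l s x]
  have hc := ((ContinuousMultilinearMap.compContinuousLinearMapL (F := V)
        (fun _ : Fin l => ContinuousLinearMap.inr ℝ ℝ E)).hasFDerivAt.comp (s, x)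
        (hd (s, x)).hasFDerivAt).fderiv
  have hc' := congrArg (fun T => T ((1 : ℝ), (0 : E))) hc
  refine hc'.trans ?_
  ext m
  exact fderiv_iteratedFDeriv_apply hg (s, x) ((1 : ℝ), (0 : E))
    fun i => ContinuousLinearMap.inr ℝ ℝ E (m i)

open Classical in
/-- A compactly supported smooth function as a Schwartz function (`0` for other functions). -/
def compactSchwartz (f : E → V) : 𝓢(E, V) :=
  if h : HasCompactSupport f ∧ ContDiff ℝ ∞ f then h.1.toSchwartzMap h.2 else 0

theorem coe_compactSchwartz {f : E → V} (h₁ : HasCompactSupport f) (h₂ : ContDiff ℝ ∞ f) :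
    ⇑(compactSchwartz f) = f := by
  ext x; simp [compactSchwartz, h₁, h₂]

/-- Each Schwartz seminorm of the error involves one iterated `x`-derivative, which is jointly
smooth in `(s, x)`. Its first order expansion in `s` is uniform on the compact set `K`, where
weights `‖x‖ ^ k` are bounded; off `K` everything vanishes. -/
theorem tendsto_slope_compactSchwartz [NormedSpace ℂ V] [SMulCommClass ℝ ℂ V] {g : ℝ × E → V} (hg : ContDiff ℝ ∞ g)
    {K : Set E} (hK : IsCompact K) (hsupp : ∀ s, tsupport (fun x => g (s, x)) ⊆ K) (s : ℝ) :
    Tendsto (slope (fun s => compactSchwartz (fun x => g (s, x))) s) (𝓝[≠] s)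
      (𝓝 (compactSchwartz (fun x => fderiv ℝ g (s, x) (1, 0)))) := by
  have hcs : ∀ t, HasCompactSupport (fun x => g (t, x)) := fun t =>
    hK.of_isClosed_subset (isClosed_tsupport _) (hsupp t)
  have hsm : ∀ t, ContDiff ℝ ∞ (fun x => g (t, x)) := fun t => by fun_prop
  have hg' : ContDiff ℝ ∞ (fderiv ℝ g) := hg.fderiv_right (by simp)
  have hzero : ∀ t, ∀ x ∉ K, g (t, x) = 0 := fun t x hx =>
    image_eq_zero_of_notMem_tsupport (f := fun x => g (t, x)) (fun h => hx (hsupp t h))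
  have hd0 : ∀ x ∉ K, fderiv ℝ g (s, x) (1, 0) = 0 := by
    intro x hx
    have : g =ᶠ[𝓝 (s, x)] fun _ => 0 := by
      have : ∀ᶠ z : ℝ × E in 𝓝 (s, x), z.2 ∈ Kᶜ :=
        continuous_snd.continuousAt (hK.isClosed.isOpen_compl.mem_nhds hx)
      filter_upwards [this] with z hz using hzero z.1 z.2 hz
    rw [this.fderiv_eq]; simp
  have hsm' : ContDiff ℝ ∞ (fun x => fderiv ℝ g (s, x) (1, 0)) := by fun_prop
  have hcs' : HasCompactSupport (fun x => fderiv ℝ g (s, x) (1, 0)) :=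
    HasCompactSupport.intro hK hd0
  rw [(schwartz_withSeminorms ℝ E V).tendsto_nhds]
  rintro ⟨k, l⟩ ε hε
  obtain ⟨R, hR0, hR⟩ : ∃ R, 0 < R ∧ ∀ x ∈ K, ‖x‖ ^ k ≤ R := by
    obtain ⟨C, hC⟩ := hK.exists_bound_of_continuousOn (f := fun x : E => ‖x‖ ^ k) (by fun_prop)
    refine ⟨max C 1, by positivity, fun x hx => le_max_of_le_left ?_⟩
    simpa using hC x hx
  set Φ : ℝ × E → E [×l]→L[ℝ] V := fun z => iteratedFDeriv ℝ l (fun y => g (z.1, y)) z.2 with hΦ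
  have hΦs : ContDiff ℝ ∞ Φ := contDiff_iteratedFDeriv_slice hg l
  have hΦ' : Continuous (fun z => fderiv ℝ Φ z (1, 0)) := by
    have : ContDiff ℝ ∞ (fderiv ℝ Φ) := hΦs.fderiv_right (by simp)
    have := this.continuous
    fun_prop
  -- An error `2 * δ * |t - s|` becomes `2 * δ * R = ε / 2` after division by `|t - s|` and
  -- multiplication by the weight.
  set δ : ℝ := ε / (4 * R) with hδ
  have hδ0 : 0 < δ := by positivity
  have hev : ∀ᶠ t in 𝓝 s, ∀ x ∈ K,
      ‖Φ (t, x) - Φ (s, x) - (t - s) • fderiv ℝ Φ (s, x) (1, 0)‖ ≤ 2 * δ * |t - s| := by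
    refine hK.eventually_forall_of_forall_eventually fun x₀ _ => ?_
    -- Strict differentiability allows both points `(t, x)` and `(s, x)` to vary near `(s, x₀)`,
    -- which is what makes the estimate locally uniform in `x`.
    have h1 := (hΦs.contDiffAt (x := (s, x₀))).hasStrictFDerivAt (by simp)
    have h2 := (hasStrictFDerivAt_iff_isLittleO.1 h1).def hδ0
    have h3 : Tendsto (fun z : ℝ × E => (z, (s, z.2))) (𝓝 (s, x₀)) (𝓝 ((s, x₀), (s, x₀))) := by
      have : Continuous (fun z : ℝ × E => (z, (s, z.2))) := by fun_prop
      exact this.tendsto' _ _ rfl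
    have h4 : ∀ᶠ z : ℝ × E in 𝓝 (s, x₀),
        ‖fderiv ℝ Φ (s, x₀) (1, 0) - fderiv ℝ Φ (s, z.2) (1, 0)‖ < δ := by
      have : Continuous (fun z : ℝ × E =>
          ‖fderiv ℝ Φ (s, x₀) (1, 0) - fderiv ℝ Φ (s, z.2) (1, 0)‖) :=
        (continuous_const.sub (hΦ'.comp (by fun_prop : Continuous fun z : ℝ × E => (s, z.2)))).norm
      exact this.continuousAt.eventually_lt continuousAt_const (by simpa using hδ0)
    filter_upwards [h3.eventually h2, h4] with z hz1 hz2
    have e1 : z - (s, z.2) = (z.1 - s) • ((1 : ℝ), (0 : E)) := by ext <;> simp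
    simp only [e1, map_smul] at hz1
    have e2 : ‖(z.1 - s) • ((1 : ℝ), (0 : E))‖ = |z.1 - s| := by
      simp [Prod.norm_def]
    rw [e2] at hz1
    have e3 : Φ (z.1, z.2) - Φ (s, z.2) - (z.1 - s) • fderiv ℝ Φ (s, z.2) (1, 0) =
        (Φ z - Φ (s, z.2) - (z.1 - s) • fderiv ℝ Φ (s, x₀) (1, 0)) +
        (z.1 - s) • (fderiv ℝ Φ (s, x₀) (1, 0) - fderiv ℝ Φ (s, z.2) (1, 0)) := by
      rw [smul_sub]; abel
    rw [e3]
    refine (norm_add_le _ _).trans ?_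
    rw [norm_smul, Real.norm_eq_abs]
    have := mul_le_mul_of_nonneg_left hz2.le (abs_nonneg (z.1 - s))
    linarith
  filter_upwards [nhdsWithin_le_nhds hev, self_mem_nhdsWithin] with t ht hts
  have hts' : 0 < |t - s| := abs_pos.2 (sub_ne_zero.2 hts)
  refine lt_of_le_of_lt (SchwartzMap.seminorm_le_bound ℝ k l _ (M := ε / 2) (by positivity) ?_)
    (by linarith)
  intro x
  have hfun : ⇑(slope (fun s => compactSchwartz (fun x => g (s, x))) s t -
      compactSchwartz (fun x => fderiv ℝ g (s, x) (1, 0))) =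
      fun x => (t - s)⁻¹ • (g (t, x) - g (s, x)) - fderiv ℝ g (s, x) (1, 0) := by
    ext y
    simp [slope_def_module, coe_compactSchwartz, hcs, hsm, hcs', hsm']
  rw [hfun]
  by_cases hx : x ∈ K
  · have hD : iteratedFDeriv ℝ l
        (fun x => (t - s)⁻¹ • (g (t, x) - g (s, x)) - fderiv ℝ g (s, x) (1, 0)) x =
        (t - s)⁻¹ • (Φ (t, x) - Φ (s, x) - (t - s) • fderiv ℝ Φ (s, x) (1, 0)) := by
      have c1 := ((hsm t).of_le (m := (l : WithTop ℕ∞)) (mod_cast le_top)).contDiffAt (x := x)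
      have c2 := ((hsm s).of_le (m := (l : WithTop ℕ∞)) (mod_cast le_top)).contDiffAt (x := x)
      have c3 := (hsm'.of_le (m := (l : WithTop ℕ∞)) (mod_cast le_top)).contDiffAt (x := x)
      rw [fderiv_iteratedFDeriv_slice hg l s x, smul_sub, smul_smul,
        inv_mul_cancel₀ (sub_ne_zero.2 hts), one_smul]
      have d1 := iteratedFDeriv_sub_apply (𝕜 := ℝ) (i := l)
        (f := fun x => (t - s)⁻¹ • (g (t, x) - g (s, x)))
        (g := fun x => fderiv ℝ g (s, x) (1, 0)) (x := x) ((c1.sub c2).const_smul _) c3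
      have d2 := iteratedFDeriv_const_smul_apply' (𝕜 := ℝ) (i := l) (a := (t - s)⁻¹) (c1.sub c2)
      have d3 := iteratedFDeriv_sub_apply (𝕜 := ℝ) (i := l) c1 c2
      refine d1.trans (congrArg₂ _ (d2.trans (congrArg _ d3)) rfl)
    rw [hD, norm_smul, norm_inv, Real.norm_eq_abs]
    calc ‖x‖ ^ k * (|t - s|⁻¹ * ‖_‖) ≤ R * (|t - s|⁻¹ * (2 * δ * |t - s|)) := by
          gcongr
          · exact hR x hx
          · exact ht x hx
      _ = ε / 2 := by rw [hδ]; field_simp; norm_num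
  · have : iteratedFDeriv ℝ l
        (fun x => (t - s)⁻¹ • (g (t, x) - g (s, x)) - fderiv ℝ g (s, x) (1, 0)) x = 0 := by
      have : (fun x => (t - s)⁻¹ • (g (t, x) - g (s, x)) - fderiv ℝ g (s, x) (1, 0))
          =ᶠ[𝓝 x] fun _ => 0 := by
        filter_upwards [hK.isClosed.isOpen_compl.mem_nhds hx] with y hy
        simp [hzero _ y hy, hd0 y hy]
      rw [(Filter.EventuallyEq.iteratedFDeriv (𝕜 := ℝ) this l).eq_of_nhds]
      simp
    rw [this]; simp; positivity

/-- A smooth family of functions with supports in a fixed compact set is differentiable as a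
curve in the Schwartz space; stated after composition with a continuous linear map into a normed
space. -/
theorem hasDerivAt_compactSchwartz [NormedSpace ℂ V] [SMulCommClass ℝ ℂ V]
    [NormedAddCommGroup W] [NormedSpace ℂ W]
    (L : 𝓢(E, V) →L[ℂ] W) {g : ℝ × E → V} (hg : ContDiff ℝ ∞ g)
    {K : Set E} (hK : IsCompact K) (hsupp : ∀ s, tsupport (fun x => g (s, x)) ⊆ K) (s : ℝ) :
    HasDerivAt (fun s => L (compactSchwartz (fun x => g (s, x))))
      (L (compactSchwartz (fun x => fderiv ℝ g (s, x) (1, 0)))) s := by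
  rw [hasDerivAt_iff_tendsto_slope]
  refine ((L.continuous.tendsto _).comp
    (tendsto_slope_compactSchwartz hg hK hsupp s)).congr fun t => ?_
  have h := (L.restrictScalars ℝ).map_smul (t - s)⁻¹
    (compactSchwartz (fun x => g (t, x)) - compactSchwartz (fun x => g (s, x)))
  simpa only [slope_def_module, Function.comp_apply, map_sub, ContinuousLinearMap.coe_restrictScalars'] using h

end SmoothFamilies

/-! ### Density of compactly supported functions in the Schwartz space -/

section Density

variable {E V : Type*} [NormedAddCommGroup E] [InnerProductSpace ℝ E]
  [NormedAddCommGroup V] [NormedSpace ℝ V]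

/-- In order zero the mean value inequality gives `ε ‖x‖`, because `ρ 0 = 1`; in positive order the
chain rule gives `ε ^ i ≤ ε`. The factor `1 + ‖x‖` is the price for a gain of `ε` in all orders. -/
theorem exists_norm_iteratedFDeriv_one_sub_cutoff_le {ρ : E → ℝ} (hρ : ContDiff ℝ ∞ ρ)
    (hc : HasCompactSupport ρ) (h0 : ρ 0 = 1) (i : ℕ) :
    ∃ M, 0 ≤ M ∧ ∀ ε : ℝ, 0 < ε → ε ≤ 1 → ∀ x,
      ‖iteratedFDeriv ℝ i (fun x => 1 - ρ (ε • x)) x‖ ≤ ε * M * (1 + ‖x‖) := by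
  have hw : ContDiff ℝ ∞ (fun x => 1 - ρ x) := by fun_prop
  rcases i with _ | i
  · obtain ⟨C, hC⟩ := (hc.fderiv (𝕜 := ℝ)).exists_bound_of_continuous
      (hρ.continuous_fderiv (by simp))
    refine ⟨C, (norm_nonneg _).trans (hC 0), fun ε hε hε1 x => ?_⟩
    have hC0 : 0 ≤ C := (norm_nonneg _).trans (hC 0)
    have h1 := Convex.norm_image_sub_le_of_norm_fderiv_le (𝕜 := ℝ) (f := ρ) (C := C)
      (s := Set.univ) (x := 0) (y := ε • x)
      (fun x _ => hρ.differentiable (by simp) x) (fun x _ => hC x) convex_univ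
      (Set.mem_univ _) (Set.mem_univ _)
    rw [h0, sub_zero, norm_smul, Real.norm_of_nonneg hε.le] at h1
    rw [norm_iteratedFDeriv_zero, norm_sub_rev]
    have : 0 ≤ ε * C := by positivity
    nlinarith [h1]
  · obtain ⟨C, hC⟩ := (hc.iteratedFDeriv (𝕜 := ℝ) (i + 1)).exists_bound_of_continuous
      ((hρ.of_le (m := ((i + 1 : ℕ) : WithTop ℕ∞)) (mod_cast le_top)).continuous_iteratedFDeriv')
    have hC0 : 0 ≤ C := (norm_nonneg _).trans (hC 0)
    refine ⟨C, hC0, fun ε hε hε1 x => ?_⟩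
    have hρε : ContDiff ℝ ∞ fun x => ρ (ε • x) := by fun_prop
    have hρ' : ContDiff ℝ ((i + 1 : ℕ) : WithTop ℕ∞) ρ := hρ.of_le (mod_cast le_top)
    have e1 := iteratedFDeriv_sub_apply (𝕜 := ℝ) (i := i + 1) (f := fun _ : E => (1 : ℝ))
      (g := fun x => ρ (ε • x)) (x := x) contDiff_const.contDiffAt
      ((hρε.of_le (m := ((i + 1 : ℕ) : WithTop ℕ∞)) (mod_cast le_top)).contDiffAt)
    have e2 : iteratedFDeriv ℝ (i + 1) (fun x => 1 - ρ (ε • x)) x =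
        - iteratedFDeriv ℝ (i + 1) (fun x => ρ (ε • x)) x := by
      refine e1.trans ?_
      rw [iteratedFDeriv_const_of_ne (by omega)]
      simp
    rw [e2, norm_neg, iteratedFDeriv_comp_const_smul _ hρ', norm_smul, norm_pow,
      Real.norm_of_nonneg hε.le]
    have h2 : ε ^ (i + 1) ≤ ε := pow_le_of_le_one hε.le hε1 (by omega)
    calc ε ^ (i + 1) * ‖iteratedFDeriv ℝ (i + 1) ρ (ε • x)‖ ≤ ε * C := by
          gcongr
          exact hC _
      _ ≤ ε * C * (1 + ‖x‖) := le_mul_of_one_le_right (by positivity) (by simp)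

/-- Multiply by cutoffs `ρ(ε x)` with `ε → 0`. In the Leibniz rule the growth `1 + ‖x‖` of the
cutoff error is absorbed by the seminorms of weight `k + 1`, and a factor `ε` remains. -/
theorem SchwartzMap.exists_tendsto_compactSchwartz [FiniteDimensional ℝ E] (φ : 𝓢(E, V)) :
    ∃ h : ℕ → E → V, (∀ k, HasCompactSupport (h k)) ∧ (∀ k, ContDiff ℝ ∞ (h k)) ∧
      Tendsto (fun k => compactSchwartz (h k)) atTop (𝓝 φ) := by
  let ρ : ContDiffBump (0 : E) := ⟨1, 2, one_pos, one_lt_two⟩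
  have hρ : ContDiff ℝ ∞ ρ := ρ.contDiff
  have hρ0 : ρ 0 = 1 := ρ.one_of_mem_closedBall (by simp [ρ])
  have hφ : ContDiff ℝ ∞ φ := φ.smooth ⊤
  set ε : ℕ → ℝ := fun k => 1 / ((k : ℝ) + 1) with hε
  have hε0 : ∀ k, 0 < ε k := fun k => by positivity
  have hε1 : ∀ k, ε k ≤ 1 := fun k => by
    rw [hε]; simp only
    rw [div_le_one (by positivity)]
    simp
  have hc : ∀ k, HasCompactSupport (fun x => ρ (ε k • x) • φ x) := fun k =>
    (ρ.hasCompactSupport.comp_homeomorph (Homeomorph.smulOfNeZero (ε k) (hε0 k).ne')).smul_right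
  have hs : ∀ k, ContDiff ℝ ∞ (fun x => ρ (ε k • x) • φ x) := fun k => by fun_prop
  refine ⟨fun k x => ρ (ε k • x) • φ x, hc, hs, ?_⟩
  rw [(schwartz_withSeminorms ℝ E V).tendsto_nhds_atTop _ _] 
  rintro ⟨k, l⟩ η hη
  choose M hM0 hM using exists_norm_iteratedFDeriv_one_sub_cutoff_le hρ ρ.hasCompactSupport hρ0
  set C : ℝ := ∑ i ∈ Finset.range (l + 1), (l.choose i : ℝ) * M i *
    (SchwartzMap.seminorm ℝ k (l - i) φ + SchwartzMap.seminorm ℝ (k + 1) (l - i) φ) with hC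
  have hC0 : 0 ≤ C := by
    refine Finset.sum_nonneg fun i _ => ?_
    have := hM0 i
    positivity
  have key : ∀ j, SchwartzMap.seminorm ℝ k l
      (compactSchwartz (fun x => ρ (ε j • x) • φ x) - φ) ≤ ε j * C := by
    intro j
    refine SchwartzMap.seminorm_le_bound ℝ k l _ (mul_nonneg (hε0 j).le hC0) fun x => ?_
    have hfun : ⇑(compactSchwartz (fun x => ρ (ε j • x) • φ x) - φ) =
        fun x => - ((1 - ρ (ε j • x)) • φ x) := by
      ext y
      simp only [sub_apply, coe_compactSchwartz (hc j) (hs j)]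
      module
    have hneg := iteratedFDeriv_neg_apply (𝕜 := ℝ) (i := l) (x := x)
      (f := fun x => (1 - ρ (ε j • x)) • φ x)
    rw [hfun]
    refine (congrArg (fun T => ‖x‖ ^ k * ‖T‖) hneg).trans_le ?_
    rw [norm_neg]
    have hle := norm_iteratedFDeriv_smul_le (𝕜 := ℝ) (n := l) (N := ∞)
      (f := fun x => 1 - ρ (ε j • x)) (g := φ) (by fun_prop) hφ x (mod_cast le_top)
    calc ‖x‖ ^ k * ‖_‖ ≤ ‖x‖ ^ k * ∑ i ∈ Finset.range (l + 1), (l.choose i : ℝ) *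
          (ε j * M i * (1 + ‖x‖)) * ‖iteratedFDeriv ℝ (l - i) φ x‖ := by
          gcongr
          refine hle.trans (Finset.sum_le_sum fun i _ => ?_)
          gcongr
          exact hM i _ (hε0 j) (hε1 j) x
      _ = ε j * ∑ i ∈ Finset.range (l + 1), (l.choose i : ℝ) * M i *
          (‖x‖ ^ k * ‖iteratedFDeriv ℝ (l - i) φ x‖ +
            ‖x‖ ^ (k + 1) * ‖iteratedFDeriv ℝ (l - i) φ x‖) := by
          simp only [Finset.mul_sum]
          refine Finset.sum_congr rfl fun i _ => ?_
          ring
      _ ≤ ε j * C := by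
          rw [hC]
          have := fun i => hM0 i
          have := (hε0 j).le
          gcongr with i hi
          · exact mul_nonneg (by positivity) (hM0 i)
          · exact SchwartzMap.le_seminorm ℝ _ _ _ _
          · exact SchwartzMap.le_seminorm ℝ _ _ _ _
  have hlim : Tendsto (fun j => ε j * C) atTop (𝓝 0) := by
    have := (tendsto_one_div_add_atTop_nhds_zero_nat (𝕜 := ℝ)).mul_const C
    simpa [hε] using this
  obtain ⟨n₀, hn₀⟩ := eventually_atTop.1 (hlim.eventually_lt_const hη)
  exact ⟨n₀, fun j hj => (key j).trans_lt (hn₀ j hj)⟩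

end Density

/-! ### The Fourier transform of `L^p` functions, tested against compactly supported functions -/

section Pairing

variable {n N : ℕ} {p : ℝ≥0∞} [Fact (1 ≤ p)]

variable (n N p) in
/-- The pairing `(φ, u) ↦ ∫ φ u` of Schwartz functions and `L^p` functions. -/
def schwartzPairing : 𝓢(EuclideanSpace ℝ (Fin n), ℂ) →L[ℂ]
    (LpSpace n N p →L[ℂ] EuclideanSpace ℂ (Fin N)) :=
  haveI := ENNReal.HolderConjugate.inv_one_sub_inv' (Fact.out : 1 ≤ p)
  haveI : ENNReal.HolderConjugate (1 - p⁻¹)⁻¹ p := ENNReal.HolderTriple.symm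
  haveI : Fact (1 ≤ (1 - p⁻¹)⁻¹) := by simp [fact_iff]
  (((ContinuousLinearMap.lsmul ℂ ℂ : ℂ →L[ℂ] EuclideanSpace ℂ (Fin N) →L[ℂ] _).lpPairing
    (volume : Measure (EuclideanSpace ℝ (Fin n))) (1 - p⁻¹)⁻¹ p)) ∘L
    SchwartzMap.toLpCLM ℂ ℂ (1 - p⁻¹)⁻¹ (volume : Measure (EuclideanSpace ℝ (Fin n)))

theorem schwartzPairing_apply (φ : 𝓢(EuclideanSpace ℝ (Fin n), ℂ)) (u : LpSpace n N p) :
    schwartzPairing n N p φ u = lpEmb n N p u φ := by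
  have h1 : lpEmb n N p u φ = ∫ x, φ x • u x := Lp.toTemperedDistribution_apply u φ
  rw [h1]
  have := ENNReal.HolderConjugate.inv_one_sub_inv' (Fact.out : 1 ≤ p)
  have : ENNReal.HolderConjugate (1 - p⁻¹)⁻¹ p := ENNReal.HolderTriple.symm
  have : Fact (1 ≤ (1 - p⁻¹)⁻¹) := by simp [fact_iff]
  refine (ContinuousLinearMap.lpPairing_eq_integral _ _ _).trans ?_
  refine integral_congr_ae ?_
  filter_upwards [φ.coeFn_toLp (1 - p⁻¹)⁻¹ volume] with x hx
  change (φ.toLp (1 - p⁻¹)⁻¹ volume) x • u x = _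
  rw [hx]

theorem schwartzPairing_eq_integral (φ : 𝓢(EuclideanSpace ℝ (Fin n), ℂ)) (u : LpSpace n N p) :
    schwartzPairing n N p φ u = ∫ x, φ x • u x :=
  (schwartzPairing_apply φ u).trans (Lp.toTemperedDistribution_apply u φ)

variable (N p) in
/-- The Fourier transform of `u ∈ L^p` tested against `χ`. -/
def fourierPairing : 𝓢(EuclideanSpace ℝ (Fin n), ℂ) →L[ℂ]
    (LpSpace n N p →L[ℂ] EuclideanSpace ℂ (Fin N)) :=
  schwartzPairing n N p ∘L
    (FourierTransform.fourierCLM ℂ 𝓢(EuclideanSpace ℝ (Fin n), ℂ))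

theorem fourierPairing_apply (χ : 𝓢(EuclideanSpace ℝ (Fin n), ℂ)) (u : LpSpace n N p) :
    fourierPairing N p χ u = lpEmb n N p u (𝓕 χ) :=
  schwartzPairing_apply _ _

/-- Tempered distributions are determined by their Fourier transforms on compactly supported
smooth functions. -/
theorem TemperedDistribution.eq_of_forall_fourier_compactSchwartz
    {T S : 𝓢'(EuclideanSpace ℝ (Fin n), EuclideanSpace ℂ (Fin N))}
    (h : ∀ χ : EuclideanSpace ℝ (Fin n) → ℂ, HasCompactSupport χ → ContDiff ℝ ∞ χ →
      T (𝓕 (compactSchwartz χ)) = S (𝓕 (compactSchwartz χ))) : T = S := by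
  ext1 φ
  obtain ⟨χ, hc, hs, hlim⟩ := (𝓕⁻ φ).exists_tendsto_compactSchwartz
  have hF : Tendsto (fun k => 𝓕 (compactSchwartz (χ k))) atTop (𝓝 φ) := by
    have := ((FourierTransform.fourierCLM ℂ 𝓢(EuclideanSpace ℝ (Fin n), ℂ)).continuous.tendsto
      _).comp hlim
    simpa [Function.comp_def] using this
  have h1 := (T.continuous.tendsto _).comp hF
  have h2 := (S.continuous.tendsto _).comp hF
  refine tendsto_nhds_unique h1 (h2.congr fun k => ?_)
  exact (h _ (hc k) (hs k)).symm

/-- This is the multiplication formula `∫ (𝓕 χ) 𝓕⁻h = ∫ (𝓕⁻𝓕 χ) h`; integrability of `h` is enough.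
-/
theorem fourierPairing_eq_integral (χ : 𝓢(EuclideanSpace ℝ (Fin n), ℂ)) {u : LpSpace n N p}
    {h : EuclideanSpace ℝ (Fin n) → EuclideanSpace ℂ (Fin N)} (hh : Integrable h)
    (hu : u =ᵐ[volume] 𝓕⁻ h) : fourierPairing N p χ u = ∫ ξ, χ ξ • h ξ := by
  have h1 : fourierPairing N p χ u = ∫ x, (𝓕 χ) x • u x := schwartzPairing_eq_integral _ _
  have h2 : ∫ x, (𝓕 χ) x • u x = ∫ x, (𝓕 χ) x • 𝓕⁻ h x := by
    refine integral_congr_ae ?_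
    filter_upwards [hu] with x hx
    rw [hx]
  rw [h1, h2]
  -- The bilinear form is minus the inner product, so that the general transform is `𝓕⁻`.
  have h3 := VectorFourier.integral_fourierIntegral_smul_eq_flip
    (μ := (volume : Measure (EuclideanSpace ℝ (Fin n))))
    (ν := (volume : Measure (EuclideanSpace ℝ (Fin n)))) (e := Real.fourierChar)
    (L := -innerₗ (EuclideanSpace ℝ (Fin n))) (f := ((𝓕 χ : 𝓢(EuclideanSpace ℝ (Fin n), ℂ)) : _ → ℂ)) (g := h)
    Real.continuous_fourierChar
    (by simp only [LinearMap.neg_apply, innerₗ_apply_apply]; fun_prop) ((𝓕 χ).integrable) hh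
  have hflip : (-innerₗ (EuclideanSpace ℝ (Fin n))).flip = -innerₗ (EuclideanSpace ℝ (Fin n)) := by
    ext x y; simp [real_inner_comm]
  rw [hflip] at h3
  refine h3.symm.trans ?_
  refine integral_congr_ae (ae_of_all _ fun ξ => ?_)
  have h4 : VectorFourier.fourierIntegral Real.fourierChar volume
      (-innerₗ (EuclideanSpace ℝ (Fin n))) ((𝓕 χ : 𝓢(EuclideanSpace ℝ (Fin n), ℂ)) : _ → ℂ) ξ =
      𝓕⁻ (𝓕 χ) ξ := by
    rw [SchwartzMap.fourierInv_coe]; rfl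
  simp only [h4, FourierTransform.fourierInv_fourier_eq]

end Pairing

/-! ### Smooth matrix symbols -/

section Symbols

variable {n N : ℕ}

theorem IsScalarSymbol.hasTemperateGrowth {μ : ℝ} {b : EuclideanSpace ℝ (Fin n) → ℂ}
    (hb : IsScalarSymbol μ b) : b.HasTemperateGrowth := by
  refine ⟨hb.1, fun k => ?_⟩
  obtain ⟨C, hC, h⟩ := hb.2 k
  -- Temperate growth asks for a natural exponent, while `μ - k` is real and possibly negative.
  refine ⟨⌈|μ - k|⌉₊, C, fun x => (h x).trans ?_⟩
  have h1 : 1 ≤ √(1 + ‖x‖ ^ 2) := by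
    rw [Real.one_le_sqrt]; nlinarith [sq_nonneg ‖x‖]
  have h2 : √(1 + ‖x‖ ^ 2) ≤ 1 + ‖x‖ := by
    rw [Real.sqrt_le_left (by positivity)]; nlinarith [norm_nonneg x]
  gcongr
  calc √(1 + ‖x‖ ^ 2) ^ (μ - k) ≤ √(1 + ‖x‖ ^ 2) ^ ((⌈|μ - k|⌉₊ : ℕ) : ℝ) :=
        Real.rpow_le_rpow_of_exponent_le h1 ((le_abs_self _).trans (Nat.le_ceil _))
    _ = √(1 + ‖x‖ ^ 2) ^ ⌈|μ - k|⌉₊ := Real.rpow_natCast _ _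
    _ ≤ (1 + ‖x‖) ^ ⌈|μ - k|⌉₊ := by gcongr

/-- Matrix-valued functions with smooth entries. -/
def IsSmoothSymbol (m : EuclideanSpace ℝ (Fin n) → Matrix (Fin N) (Fin N) ℂ) : Prop :=
  ∀ i j, ContDiff ℝ ∞ (fun ξ => m ξ i j)

section Exp

open scoped Matrix.Norms.Operator

theorem contDiff_matrix {Z : Type*} [NormedAddCommGroup Z] [NormedSpace ℝ Z]
    {f : Z → Matrix (Fin N) (Fin N) ℂ} :
    ContDiff ℝ ∞ f ↔ ∀ i j, ContDiff ℝ ∞ (fun z => f z i j) := by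
  constructor
  · intro h i j
    exact (LinearMap.toContinuousLinearMap (Matrix.entryLinearMap ℝ ℂ i j)).contDiff.comp h
  · intro h
    have hf : f = fun z => ∑ i, ∑ j, f z i j • Matrix.single i j (1 : ℂ) := by
      ext1 z
      conv_lhs => rw [Matrix.matrix_eq_sum_single (f z)]
      simp [Matrix.smul_single]
    rw [hf]
    exact ContDiff.sum fun i _ => ContDiff.sum fun j _ => (h i j).smul contDiff_const

/-- Smoothness is joint in time and frequency, as needed for smooth families of test functions. -/
theorem contDiff_expSymbol {b : EuclideanSpace ℝ (Fin n) → Matrix (Fin N) (Fin N) ℂ}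
    (hb : IsSmoothSymbol b) (i j : Fin N) :
    ContDiff ℝ ∞ (fun z : ℝ × EuclideanSpace ℝ (Fin n) => expSymbol b z.1 z.2 i j) := by
  have hexp : ContDiff ℝ ∞ (fun A : Matrix (Fin N) (Fin N) ℂ => NormedSpace.exp A) :=
    AnalyticOnNhd.contDiff fun x _ => NormedSpace.exp_analytic x
  have hb' : ContDiff ℝ ∞ b := contDiff_matrix.2 hb
  have h : ContDiff ℝ ∞ (fun z : ℝ × EuclideanSpace ℝ (Fin n) => NormedSpace.exp (z.1 • b z.2)) :=
    hexp.comp (contDiff_fst.smul (hb'.comp contDiff_snd))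
  exact contDiff_matrix.1 h i j

theorem hasDerivAt_expSymbol (b : EuclideanSpace ℝ (Fin n) → Matrix (Fin N) (Fin N) ℂ)
    (s : ℝ) (ξ : EuclideanSpace ℝ (Fin n)) (i j : Fin N) :
    HasDerivAt (fun s => expSymbol b s ξ i j) ((expSymbol b s ξ * b ξ) i j) s := by
  have h := hasDerivAt_exp_smul_const (𝕂 := ℝ) (b ξ) s
  exact (LinearMap.toContinuousLinearMap (Matrix.entryLinearMap ℝ ℂ i j)).hasFDerivAt.comp_hasDerivAt
    s h

theorem expSymbol_add (b : EuclideanSpace ℝ (Fin n) → Matrix (Fin N) (Fin N) ℂ) (s t : ℝ)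
    (ξ : EuclideanSpace ℝ (Fin n)) :
    expSymbol b (s + t) ξ = expSymbol b s ξ * expSymbol b t ξ := by
  simp only [expSymbol, add_smul]
  exact NormedSpace.exp_add_of_commute (((Commute.refl (b ξ)).smul_left s).smul_right t)

theorem expSymbol_mul_comm (b : EuclideanSpace ℝ (Fin n) → Matrix (Fin N) (Fin N) ℂ) (t : ℝ)
    (ξ : EuclideanSpace ℝ (Fin n)) : expSymbol b t ξ * b ξ = b ξ * expSymbol b t ξ :=
  (((Commute.refl (b ξ)).smul_left t).exp_left).eq

theorem expSymbol_zero (b : EuclideanSpace ℝ (Fin n) → Matrix (Fin N) (Fin N) ℂ)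
    (ξ : EuclideanSpace ℝ (Fin n)) : expSymbol b 0 ξ = 1 := by
  simp [expSymbol]

end Exp

theorem IsSmoothSymbol.expSymbol {b : EuclideanSpace ℝ (Fin n) → Matrix (Fin N) (Fin N) ℂ}
    (hb : IsSmoothSymbol b) (t : ℝ) : IsSmoothSymbol (expSymbol b t) := fun i j =>
  (contDiff_expSymbol hb i j).comp (by fun_prop : ContDiff ℝ ∞ fun ξ => (t, ξ))

end Symbols

/-! ### Zero, products and finite sums of compactly supported functions -/

section Related

theorem hasCompactSupport_const_zero {E V : Type*} [TopologicalSpace E] [Zero V] :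
    HasCompactSupport (fun _ : E => (0 : V)) :=
  HasCompactSupport.zero

theorem HasCompactSupport.fun_mul_left {E : Type*} [TopologicalSpace E] {χ : E → ℂ}
    (hc : HasCompactSupport χ) (f : E → ℂ) : HasCompactSupport (fun x => f x * χ x) :=
  hc.mul_left

variable {E V : Type*} [NormedAddCommGroup E] [NormedSpace ℝ E]
  [NormedAddCommGroup V] [NormedSpace ℝ V]

theorem compactSchwartz_zero : compactSchwartz (fun _ : E => (0 : V)) = 0 := by
  ext x
  rw [coe_compactSchwartz hasCompactSupport_const_zero contDiff_const]
  rfl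

theorem compactSchwartz_finset_sum {ι : Type*} (s : Finset ι) {f : ι → E → V}
    (hc : ∀ i, HasCompactSupport (f i)) (hs : ∀ i, ContDiff ℝ ∞ (f i)) :
    compactSchwartz (fun x => ∑ i ∈ s, f i x) = ∑ i ∈ s, compactSchwartz (f i) := by
  have hc' : HasCompactSupport (fun x => ∑ i ∈ s, f i x) := by
    classical
    induction s using Finset.induction_on with
    | empty => simpa using hasCompactSupport_const_zero
    | insert a t ha ih =>
      simp only [Finset.sum_insert ha]
      exact (hc a).add ih
  ext x
  rw [coe_compactSchwartz hc' (ContDiff.sum fun i _ => hs i), sum_apply]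
  exact Finset.sum_congr rfl fun i _ => by rw [coe_compactSchwartz (hc i) (hs i)]

end Related

/-! ### Relations `v̂ = m û` between `L^p` functions -/

section FourierRelated

variable {n N : ℕ} {p : ℝ≥0∞} [Fact (1 ≤ p)]
  {m m' b : EuclideanSpace ℝ (Fin n) → Matrix (Fin N) (Fin N) ℂ}

variable (p) in
/-- The functional `u ↦ (m û)(χ)`. -/
def symbolPairing (m : EuclideanSpace ℝ (Fin n) → Matrix (Fin N) (Fin N) ℂ)
    (χ : EuclideanSpace ℝ (Fin n) → ℂ) : LpSpace n N p →L[ℂ] EuclideanSpace ℂ (Fin N) :=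
  ∑ i, ∑ j, (Matrix.toEuclideanCLM (n := Fin N) (𝕜 := ℂ) (Matrix.single i j 1)) ∘L
    fourierPairing N p (compactSchwartz fun ξ => m ξ i j * χ ξ)

theorem toEuclideanCLM_single_apply (k j : Fin N) (v : EuclideanSpace ℂ (Fin N)) (i : Fin N) :
    Matrix.toEuclideanCLM (n := Fin N) (𝕜 := ℂ) (Matrix.single k j 1) v i =
      if i = k then v j else 0 := by
  change (Matrix.single k j (1 : ℂ)).mulVec _ i = _
  rw [Matrix.single_mulVec]
  by_cases h : i = k
  · subst h; simp
  · simp [h]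

theorem symbolPairing_apply (m : EuclideanSpace ℝ (Fin n) → Matrix (Fin N) (Fin N) ℂ)
    (χ : EuclideanSpace ℝ (Fin n) → ℂ) (u : LpSpace n N p) (i : Fin N) :
    symbolPairing p m χ u i =
      ∑ j, fourierPairing N p (compactSchwartz fun ξ => m ξ i j * χ ξ) u j := by
  simp only [symbolPairing, sum_apply, WithLp.ofLp_sum, Finset.sum_apply,
    ContinuousLinearMap.comp_apply, toEuclideanCLM_single_apply]
  rw [Finset.sum_comm]
  simp

/-- `v̂ = m û` for `u, v ∈ L^p`, where the entries of `m` are smooth (of arbitrary growth). -/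
def IsFourierRelated (m : EuclideanSpace ℝ (Fin n) → Matrix (Fin N) (Fin N) ℂ)
    (u v : LpSpace n N p) : Prop :=
  ∀ χ : EuclideanSpace ℝ (Fin n) → ℂ, HasCompactSupport χ → ContDiff ℝ ∞ χ →
    fourierPairing N p (compactSchwartz χ) v = symbolPairing p m χ u

theorem eq_of_forall_fourierPairing {u v : LpSpace n N p}
    (h : ∀ χ : EuclideanSpace ℝ (Fin n) → ℂ, HasCompactSupport χ → ContDiff ℝ ∞ χ →
      fourierPairing N p (compactSchwartz χ) u = fourierPairing N p (compactSchwartz χ) v) :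
    u = v := by
  refine lpEmb_injective n N p (TemperedDistribution.eq_of_forall_fourier_compactSchwartz ?_)
  intro χ hc hs
  simpa only [fourierPairing_apply] using h χ hc hs

theorem IsFourierRelated.unique {u v w : LpSpace n N p} (hv : IsFourierRelated m u v)
    (hw : IsFourierRelated m u w) : v = w :=
  eq_of_forall_fourierPairing fun χ hc hs => (hv χ hc hs).trans (hw χ hc hs).symm

/-- The functions `m' i j * χ` are again admissible test functions whatever the growth of `m'`, so
the relation for `m` can be applied to each of them; summing the entries produces the matrix
product. -/
theorem IsFourierRelated.symbolPairing_eq {u v : LpSpace n N p} (h : IsFourierRelated m u v)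
    (hm : IsSmoothSymbol m) (hm' : IsSmoothSymbol m') {χ : EuclideanSpace ℝ (Fin n) → ℂ}
    (hc : HasCompactSupport χ) (hs : ContDiff ℝ ∞ χ) :
    symbolPairing p m' χ v = symbolPairing p (fun ξ => m' ξ * m ξ) χ u := by
  ext i
  rw [symbolPairing_apply, symbolPairing_apply]
  have h1 : ∀ j, fourierPairing N p (compactSchwartz fun ξ => m' ξ i j * χ ξ) v j =
      ∑ k, fourierPairing N p (compactSchwartz fun ξ => m ξ j k * (m' ξ i j * χ ξ)) u k := by
    intro j
    rw [h _ (hc.fun_mul_left _) ((hm' i j).mul hs), symbolPairing_apply]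
  simp only [h1]
  rw [Finset.sum_comm]
  refine Finset.sum_congr rfl fun k _ => ?_
  have h2 : (fun ξ => (m' ξ * m ξ) i k * χ ξ) =
      fun ξ => ∑ j, m ξ j k * (m' ξ i j * χ ξ) := by
    ext ξ
    rw [Matrix.mul_apply, Finset.sum_mul]
    exact Finset.sum_congr rfl fun j _ => by ring
  rw [h2, compactSchwartz_finset_sum _ (fun j => (hc.fun_mul_left _).fun_mul_left _)
    (fun j => (hm j k).mul ((hm' i j).mul hs))]
  simp only [map_sum, sum_apply, WithLp.ofLp_sum, Finset.sum_apply]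

theorem IsFourierRelated.trans {u v w : LpSpace n N p} (h : IsFourierRelated m u v)
    (h' : IsFourierRelated m' v w) (hm : IsSmoothSymbol m) (hm' : IsSmoothSymbol m') :
    IsFourierRelated (fun ξ => m' ξ * m ξ) u w := fun χ hc hs =>
  (h' χ hc hs).trans (h.symbolPairing_eq hm hm' hc hs)

theorem isFourierRelated_one (u : LpSpace n N p) :
    IsFourierRelated (fun _ => (1 : Matrix (Fin N) (Fin N) ℂ)) u u := by
  intro χ hc hs
  ext i
  rw [symbolPairing_apply, Finset.sum_eq_single i]
  · simp
  · intro j _ hj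
    simp [Matrix.one_apply_ne hj.symm, compactSchwartz_zero]
  · simp

theorem isFourierRelated_expSymbol_zero (u : LpSpace n N p) :
    IsFourierRelated (expSymbol b 0) u u := by
  have : expSymbol b 0 = fun _ => 1 := funext (expSymbol_zero b)
  rw [this]
  exact isFourierRelated_one u

/-- The derivative of `s ↦ e^{sb} û` in the weak sense. -/
theorem hasDerivAt_symbolPairing_expSymbol (hb : IsSmoothSymbol b)
    {χ : EuclideanSpace ℝ (Fin n) → ℂ} (hc : HasCompactSupport χ) (hs : ContDiff ℝ ∞ χ) (s : ℝ) :
    HasDerivAt (fun s => symbolPairing p (expSymbol b s) χ)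
      (symbolPairing p (fun ξ => expSymbol b s ξ * b ξ) χ) s := by
  simp only [symbolPairing]
  refine HasDerivAt.fun_sum fun i _ => HasDerivAt.fun_sum fun j _ => ?_
  set g : ℝ × EuclideanSpace ℝ (Fin n) → ℂ := fun z => expSymbol b z.1 z.2 i j * χ z.2 with hg
  have hgs : ContDiff ℝ ∞ g := (contDiff_expSymbol hb i j).mul (hs.comp contDiff_snd)
  have hsupp : ∀ s, tsupport (fun x => g (s, x)) ⊆ tsupport χ := fun s =>
    closure_mono (Function.support_mul_subset_right _ _)
  have hd := hasDerivAt_compactSchwartz (fourierPairing N p) hgs hc hsupp s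
  have hd' : (fun x => fderiv ℝ g (s, x) (1, 0)) =
      fun ξ => (expSymbol b s ξ * b ξ) i j * χ ξ := by
    ext ξ
    -- The time derivative of `g` is read off along the line `r ↦ (r, ξ)`, where it is the
    -- derivative of the matrix exponential.
    have h1 : HasDerivAt (fun r : ℝ => (r, ξ)) ((1 : ℝ), (0 : EuclideanSpace ℝ (Fin n))) s :=
      (hasDerivAt_id s).prodMk (hasDerivAt_const s ξ)
    have h2 := (hgs.differentiable (by simp) (s, ξ)).hasFDerivAt.comp_hasDerivAt s h1
    exact h2.unique ((hasDerivAt_expSymbol b s ξ i j).mul_const (χ ξ))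
  rw [hd'] at hd
  exact ((ContinuousLinearMap.compL ℂ (LpSpace n N p) _ _ (Matrix.toEuclideanCLM (n := Fin N)
    (𝕜 := ℂ) (Matrix.single i j 1))).restrictScalars ℝ).hasFDerivAt.comp_hasDerivAt s hd

/-- `u, v` with smooth, compactly supported Fourier transforms `h` and `m h`. -/
theorem isFourierRelated_of_ae_eq_fourierInv {u v : LpSpace n N p}
    {h h' : EuclideanSpace ℝ (Fin n) → EuclideanSpace ℂ (Fin N)} (hh : Integrable h)
    (hh' : Integrable h') (hu : u =ᵐ[volume] 𝓕⁻ h) (hv : v =ᵐ[volume] 𝓕⁻ h')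
    (hm : IsSmoothSymbol m)
    (hm' : ∀ ξ, h' ξ = Matrix.toEuclideanCLM (n := Fin N) (𝕜 := ℂ) (m ξ) (h ξ)) :
    IsFourierRelated m u v := by
  intro χ hc hs
  have hint : ∀ φ : 𝓢(EuclideanSpace ℝ (Fin n), ℂ), ∀ {h : EuclideanSpace ℝ (Fin n) →
      EuclideanSpace ℂ (Fin N)}, Integrable h → Integrable (fun ξ => φ ξ • h ξ) := by
    intro φ h hh
    refine hh.bdd_smul (C := SchwartzMap.seminorm ℝ 0 0 φ) φ.continuous.aestronglyMeasurable
      (ae_of_all _ fun ξ => φ.norm_le_seminorm ℝ ξ)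
  have hcomp : ∀ {f : EuclideanSpace ℝ (Fin n) → EuclideanSpace ℂ (Fin N)}, Integrable f →
      ∀ i, (∫ ξ, f ξ) i = ∫ ξ, f ξ i := fun hf i =>
    ((EuclideanSpace.proj (𝕜 := ℂ) i).integral_comp_comm hf).symm
  have hcint : ∀ {f : EuclideanSpace ℝ (Fin n) → EuclideanSpace ℂ (Fin N)}, Integrable f →
      ∀ i, Integrable fun ξ => f ξ i := fun hf i =>
    (EuclideanSpace.proj (𝕜 := ℂ) i).integrable_comp hf
  ext i
  rw [symbolPairing_apply, fourierPairing_eq_integral _ hh' hv, hcomp (hint _ hh')]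
  have h1 : ∀ j, fourierPairing N p (compactSchwartz fun ξ => m ξ i j * χ ξ) u j =
      ∫ ξ, (compactSchwartz fun ξ => m ξ i j * χ ξ) ξ * h ξ j := by
    intro j
    rw [fourierPairing_eq_integral _ hh hu, hcomp (hint _ hh)]
    rfl
  simp only [h1]
  have h3 : ∀ j ∈ Finset.univ, Integrable
      (fun ξ => (compactSchwartz fun ξ => m ξ i j * χ ξ) ξ * h ξ j) := fun j _ =>
    hcint (hint (compactSchwartz fun ξ => m ξ i j * χ ξ) hh) j
  rw [← integral_finsetSum _ h3]
  refine integral_congr_ae (ae_of_all _ fun ξ => ?_)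
  have h2 : Matrix.toEuclideanCLM (n := Fin N) (𝕜 := ℂ) (m ξ) (h ξ) i = ∑ j, m ξ i j * h ξ j := rfl
  simp only [coe_compactSchwartz hc hs, PiLp.smul_apply, smul_eq_mul, hm', h2, Finset.mul_sum,
    coe_compactSchwartz (hc.fun_mul_left _) ((hm i _).mul hs)]
  exact Finset.sum_congr rfl fun j _ => by ring

end FourierRelated

/-! ### The maximal realization in terms of Fourier transforms -/

section Realization

variable {n N : ℕ} {p : ℝ≥0∞} [Fact (1 ≤ p)]
  {a m : EuclideanSpace ℝ (Fin n) → Matrix (Fin N) (Fin N) ℂ}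

/-- The symbol in the variable of Mathlib's normalization of the Fourier transform. -/
def dilatedSymbol (a : EuclideanSpace ℝ (Fin n) → Matrix (Fin N) (Fin N) ℂ) :
    EuclideanSpace ℝ (Fin n) → Matrix (Fin N) (Fin N) ℂ :=
  fun ξ => a (-(2 * Real.pi) • ξ)

theorem IsMatrixSymbol.hasTemperateGrowth_dilatedSymbol {μ : ℝ} (ha : IsMatrixSymbol μ a)
    (i j : Fin N) : (fun ξ => dilatedSymbol a ξ i j).HasTemperateGrowth :=
  (ha i j).hasTemperateGrowth.comp
    (-(2 * Real.pi) • ContinuousLinearMap.id ℝ (EuclideanSpace ℝ (Fin n))).hasTemperateGrowth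

theorem dilatedSymbol_expSymbol (t : ℝ) :
    dilatedSymbol (expSymbol a t) = expSymbol (dilatedSymbol a) t := rfl

theorem mem_graph_maximalRealization {u v : LpSpace n N p} :
    (u, v) ∈ (maximalRealization p a).graph ↔ lpEmb n N p v = opDistribution a (lpEmb n N p u) := by
  rw [LinearPMap.mem_graph_iff]
  constructor
  · rintro ⟨y, rfl, rfl⟩
    exact lpEmb_maximalRealization p a y
  · intro h
    have hu : u ∈ (maximalRealization p a).domain := ⟨v, h⟩
    refine ⟨⟨u, hu⟩, rfl, lpEmb_injective n N p ?_⟩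
    rw [lpEmb_maximalRealization, h]

/-- Temperate growth makes multiplication by the symbol an operation on Schwartz functions; on
compactly supported ones it is the pointwise product used in `symbolPairing`. -/
theorem opDistribution_fourier_compactSchwartz
    (ha : ∀ i j, (fun ξ => dilatedSymbol a ξ i j).HasTemperateGrowth) (u : LpSpace n N p)
    {χ : EuclideanSpace ℝ (Fin n) → ℂ} (hc : HasCompactSupport χ) (hs : ContDiff ℝ ∞ χ) :
    opDistribution a (lpEmb n N p u) (𝓕 (compactSchwartz χ)) =
      symbolPairing p (dilatedSymbol a) χ u := by
  ext i
  rw [opDistribution_apply, symbolPairing_apply]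
  refine Finset.sum_congr rfl fun j _ => ?_
  have h : SchwartzMap.smulLeftCLM ℂ (fun ξ => a (-(2 * Real.pi) • ξ) i j) (compactSchwartz χ) =
      compactSchwartz fun ξ => dilatedSymbol a ξ i j * χ ξ := by
    ext ξ
    refine (SchwartzMap.smulLeftCLM_apply_apply (ha i j) _ _).trans ?_
    rw [coe_compactSchwartz hc hs, coe_compactSchwartz (hc.fun_mul_left _) ((ha i j).1.mul hs)]
    rfl
  rw [fourierPairing_apply, FourierTransform.fourierInv_fourier_eq, h]

theorem mem_graph_iff_isFourierRelated
    (ha : ∀ i j, (fun ξ => dilatedSymbol a ξ i j).HasTemperateGrowth) {u v : LpSpace n N p} :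
    (u, v) ∈ (maximalRealization p a).graph ↔ IsFourierRelated (dilatedSymbol a) u v := by
  rw [mem_graph_maximalRealization]
  constructor
  · intro h χ hc hs
    rw [fourierPairing_apply, h, opDistribution_fourier_compactSchwartz ha u hc hs]
  · intro h
    refine TemperedDistribution.eq_of_forall_fourier_compactSchwartz fun χ hc hs => ?_
    rw [opDistribution_fourier_compactSchwartz ha u hc hs, ← h χ hc hs, fourierPairing_apply]

/-- For each fixed `χ` both sides of the relation are continuous in `(u, v)`. -/
theorem isClosed_setOf_isFourierRelated (m : EuclideanSpace ℝ (Fin n) → Matrix (Fin N) (Fin N) ℂ) :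
    IsClosed {x : LpSpace n N p × LpSpace n N p | IsFourierRelated m x.1 x.2} := by
  simp only [IsFourierRelated, Set.ofPred_forall]
  refine isClosed_iInter fun χ => isClosed_iInter fun _ => isClosed_iInter fun _ => ?_
  exact isClosed_eq (by fun_prop) (by fun_prop)

theorem isClosed_maximalRealization
    (ha : ∀ i j, (fun ξ => dilatedSymbol a ξ i j).HasTemperateGrowth) :
    (maximalRealization p a).IsClosed := by
  have h : ((maximalRealization p a).graph : Set (LpSpace n N p × LpSpace n N p)) =
      {x | IsFourierRelated (dilatedSymbol a) x.1 x.2} := by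
    ext ⟨u, v⟩
    exact mem_graph_iff_isFourierRelated ha
  rw [LinearPMap.IsClosed, h]
  exact isClosed_setOf_isFourierRelated _

/-- The `L^p` function whose Fourier transform is the compactly supported smooth function `h`. -/
def ofFourier (p : ℝ≥0∞) (h : EuclideanSpace ℝ (Fin n) → EuclideanSpace ℂ (Fin N)) :
    LpSpace n N p :=
  (𝓕⁻ (compactSchwartz h)).toLp p

theorem ofFourier_ae_eq {q : ℝ≥0∞} {h : EuclideanSpace ℝ (Fin n) → EuclideanSpace ℂ (Fin N)}
    (hc : HasCompactSupport h) (hs : ContDiff ℝ ∞ h) :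
    ofFourier q h =ᵐ[volume] 𝓕⁻ h := by
  filter_upwards [(𝓕⁻ (compactSchwartz h)).coeFn_toLp q volume] with x hx
  rw [ofFourier, hx, SchwartzMap.fourierInv_coe, coe_compactSchwartz hc hs]

/-- Schwartz functions are dense since `p ≠ ⊤`, and cutting off their Fourier transforms converges
in the Schwartz topology, hence in `L^p`. -/
theorem dense_range_ofFourier (hp : p ≠ ⊤) :
    Dense {u : LpSpace n N p | ∃ h, HasCompactSupport h ∧ ContDiff ℝ ∞ h ∧ u = ofFourier p h} := by
  have hd : DenseRange (SchwartzMap.toLpCLM ℂ (EuclideanSpace ℂ (Fin N)) p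
      (volume : Measure (EuclideanSpace ℝ (Fin n)))) :=
    SchwartzMap.denseRange_toLpCLM (F := EuclideanSpace ℂ (Fin N)) hp
  refine (Dense.mono ?_ hd).of_closure
  rintro _ ⟨φ, rfl⟩
  obtain ⟨h, hc, hs, hlim⟩ := (𝓕 φ).exists_tendsto_compactSchwartz
  have h1 := ((FourierTransform.fourierInvCLM ℂ
    𝓢(EuclideanSpace ℝ (Fin n), EuclideanSpace ℂ (Fin N))).continuous.tendsto _).comp hlim
  have h2 := ((SchwartzMap.toLpCLM ℂ (EuclideanSpace ℂ (Fin N)) p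
      (volume : Measure (EuclideanSpace ℝ (Fin n)))).continuous.tendsto _).comp h1
  simp only [FourierTransform.fourierInvCLM_apply, FourierTransform.fourierInv_fourier_eq] at h2
  exact mem_closure_of_tendsto h2 (Eventually.of_forall fun k => ⟨h k, hc k, hs k, rfl⟩)

/-- Pointwise application of a matrix-valued function. -/
def applySymbol (m : EuclideanSpace ℝ (Fin n) → Matrix (Fin N) (Fin N) ℂ)
    (h : EuclideanSpace ℝ (Fin n) → EuclideanSpace ℂ (Fin N)) :
    EuclideanSpace ℝ (Fin n) → EuclideanSpace ℂ (Fin N) :=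
  fun ξ => Matrix.toEuclideanCLM (n := Fin N) (𝕜 := ℂ) (m ξ) (h ξ)

theorem applySymbol_apply (m : EuclideanSpace ℝ (Fin n) → Matrix (Fin N) (Fin N) ℂ)
    (h : EuclideanSpace ℝ (Fin n) → EuclideanSpace ℂ (Fin N)) (ξ : EuclideanSpace ℝ (Fin n))
    (i : Fin N) : applySymbol m h ξ i = ∑ j, m ξ i j * h ξ j := rfl

theorem HasCompactSupport.applySymbol {h : EuclideanSpace ℝ (Fin n) → EuclideanSpace ℂ (Fin N)}
    (hc : HasCompactSupport h) : HasCompactSupport (applySymbol m h) :=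
  hc.mono fun ξ hξ h0 => hξ (by simp [_root_.applySymbol, h0])

theorem IsSmoothSymbol.applySymbol {h : EuclideanSpace ℝ (Fin n) → EuclideanSpace ℂ (Fin N)}
    (hm : IsSmoothSymbol m) (hs : ContDiff ℝ ∞ h) : ContDiff ℝ ∞ (applySymbol m h) := by
  refine (contDiff_piLp 2).2 fun i => ?_
  simp only [applySymbol_apply]
  exact ContDiff.sum fun j _ => (hm i j).mul ((contDiff_piLp 2).1 hs j)

theorem isFourierRelated_ofFourier {h : EuclideanSpace ℝ (Fin n) → EuclideanSpace ℂ (Fin N)}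
    (hc : HasCompactSupport h) (hs : ContDiff ℝ ∞ h) (hm : IsSmoothSymbol m) :
    IsFourierRelated m (ofFourier p h) (ofFourier p (applySymbol m h)) :=
  isFourierRelated_of_ae_eq_fourierInv (hs.continuous.integrable_of_hasCompactSupport hc)
    ((hm.applySymbol hs).continuous.integrable_of_hasCompactSupport hc.applySymbol)
    (ofFourier_ae_eq hc hs) (ofFourier_ae_eq hc.applySymbol (hm.applySymbol hs)) hm fun _ => rfl

theorem LinearPMap.mem_domain_of_mem_graph' {X : Type*} [AddCommGroup X] [Module ℂ X]
    {A : X →ₗ.[ℂ] X} {x y : X} (h : (x, y) ∈ A.graph) : ∃ hx : x ∈ A.domain, A ⟨x, hx⟩ = y := by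
  obtain ⟨z, rfl, rfl⟩ := (LinearPMap.mem_graph_iff A).1 h
  exact ⟨z.2, rfl⟩

theorem ofFourier_mem_domain
    (ha : ∀ i j, (fun ξ => dilatedSymbol a ξ i j).HasTemperateGrowth)
    {h : EuclideanSpace ℝ (Fin n) → EuclideanSpace ℂ (Fin N)}
    (hc : HasCompactSupport h) (hs : ContDiff ℝ ∞ h) :
    ofFourier p h ∈ (maximalRealization p a).domain :=
  (LinearPMap.mem_domain_of_mem_graph' ((mem_graph_iff_isFourierRelated ha).2
    (isFourierRelated_ofFourier hc hs fun i j => (ha i j).1))).1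

theorem dense_domain_maximalRealization (hp : p ≠ ⊤)
    (ha : ∀ i j, (fun ξ => dilatedSymbol a ξ i j).HasTemperateGrowth) :
    Dense ((maximalRealization p a).domain : Set (LpSpace n N p)) := by
  refine (dense_range_ofFourier hp).mono ?_
  rintro _ ⟨h, hc, hs, rfl⟩
  exact ofFourier_mem_domain ha hc hs

/-- For Schwartz functions this is the multiplication formula; both `hm.op` and the closed relation
then pass to limits. -/
theorem IsLpFourierMultiplier.isFourierRelated_op (hp : p ≠ ⊤) (hm : IsLpFourierMultiplier p m)
    (hms : IsSmoothSymbol (dilatedSymbol m)) (u : LpSpace n N p) :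
    IsFourierRelated (dilatedSymbol m) u (hm.op u) := by
  have hd : DenseRange (SchwartzMap.toLpCLM ℂ (EuclideanSpace ℂ (Fin N)) p
      (volume : Measure (EuclideanSpace ℝ (Fin n)))) :=
    SchwartzMap.denseRange_toLpCLM (F := EuclideanSpace ℂ (Fin N)) hp
  refine hd.induction_on (p := fun u => IsFourierRelated (dilatedSymbol m) u (hm.op u)) u ?_ ?_
  · exact (isClosed_setOf_isFourierRelated (dilatedSymbol m)).preimage
      (by fun_prop : Continuous fun u => (u, hm.op u))
  · intro φ
    have h1 : φ.toLp p volume =ᵐ[volume]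
        𝓕⁻ (𝓕 (φ : EuclideanSpace ℝ (Fin n) → EuclideanSpace ℂ (Fin N))) := by
      filter_upwards [φ.coeFn_toLp p volume] with x hx
      rw [hx, ← SchwartzMap.fourier_coe, ← SchwartzMap.fourierInv_coe,
        FourierTransform.fourierInv_fourier_eq]
    have h2 : hm.op (φ.toLp p volume) =ᵐ[volume] opSchwartz m φ := by
      rw [hm.op_toLp hp]
      exact MemLp.coeFn_toLp _
    exact isFourierRelated_of_ae_eq_fourierInv (𝓕 φ).integrable
      (integrable_symbol_mul_fourier hm.memLp_top φ) h1 h2 hms fun _ => rfl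

/-- A classical solution satisfies `û(t) = e^{tb} û(0)`. -/
theorem IsClassicalSolution.isFourierRelated
    (ha : ∀ i j, (fun ξ => dilatedSymbol a ξ i j).HasTemperateGrowth) {u₀ : LpSpace n N p}
    {u : ℝ → LpSpace n N p} (hu : IsClassicalSolution (maximalRealization p a) u₀ u) {t : ℝ}
    (ht : 0 ≤ t) : IsFourierRelated (expSymbol (dilatedSymbol a) t) u₀ (u t) := by
  have hb : IsSmoothSymbol (dilatedSymbol a) := fun i j => (ha i j).1
  rcases ht.eq_or_lt with rfl | ht
  · rw [hu.initial]
    exact isFourierRelated_expSymbol_zero u₀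
  intro χ hc hs
  set b := dilatedSymbol a with hbdef
  -- Duhamel's device: `P s (u s)` is `e^{(t-s)b} û(s)` tested against `χ`. The derivative of the
  -- exponential cancels that of `u`, and the endpoints `s = 0`, `s = t` are the two sides of the
  -- claim.
  set P : ℝ → LpSpace n N p →L[ℂ] EuclideanSpace ℂ (Fin N) :=
    fun s => symbolPairing p (expSymbol b (t - s)) χ with hP
  have hPd : ∀ s, HasDerivAt P
      (-symbolPairing p (fun ξ => expSymbol b (t - s) ξ * b ξ) χ) s := by
    intro s
    have h1 := hasDerivAt_symbolPairing_expSymbol (p := p) hb hc hs (t - s)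
    have h2 : HasDerivAt (fun s => t - s) (-1) s := by
      simpa using (hasDerivAt_id s).const_sub t
    have h3 := h1.scomp s h2
    rw [neg_one_smul] at h3
    exact h3
  have hcont : ContinuousOn (fun s => P s (u s)) (Set.Icc 0 t) := by
    have hPc : Continuous P := continuous_iff_continuousAt.2 fun s => (hPd s).continuousAt
    exact hPc.continuousOn.clm_apply
      (hu.contDiffOn.continuousOn.mono Set.Icc_subset_Ici_self)
  have hder : ∀ s, 0 < s → HasDerivAt (fun s => P s (u s)) 0 s := by
    intro s hs0
    obtain ⟨hdom, hus⟩ := hu.equation s hs0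
    have h1 : HasDerivAt (fun s => (P s).restrictScalars ℝ)
        ((-symbolPairing p (fun ξ => expSymbol b (t - s) ξ * b ξ) χ).restrictScalars ℝ) s :=
      (ContinuousLinearMap.restrictScalarsL ℂ (LpSpace n N p) (EuclideanSpace ℂ (Fin N)) ℝ
        ℝ).hasFDerivAt.comp_hasDerivAt s (hPd s)
    have h2 := h1.clm_apply hus
    have h3 : IsFourierRelated b (u s) (maximalRealization p a ⟨u s, hdom⟩) :=
      (mem_graph_iff_isFourierRelated ha).1 (LinearPMap.mem_graph _ ⟨u s, hdom⟩)
    have h4 := h3.symbolPairing_eq hb (hb.expSymbol (t - s)) hc hs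
    refine h2.congr_deriv ?_
    change -(symbolPairing p (fun ξ => expSymbol b (t - s) ξ * b ξ) χ (u s)) +
      symbolPairing p (expSymbol b (t - s)) χ (maximalRealization p a ⟨u s, hdom⟩) = 0
    rw [h4, neg_add_cancel]
  -- The equation holds only for positive times, so the value at `s = 0` is recovered by continuity.
  have hconst : ∀ s ∈ Set.Ioc 0 t, P s (u s) = P t (u t) := by
    intro s hs0
    refine (constant_of_has_deriv_right_zero
      (hcont.mono (Set.Icc_subset_Icc_left hs0.1.le))
      (fun x hx => (hder x (hs0.1.trans_le hx.1)).hasDerivWithinAt) t ⟨hs0.2, le_rfl⟩).symm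
  have hlim : Tendsto (fun s => P s (u s)) (𝓝[>] 0) (𝓝 (P 0 (u 0))) := by
    refine ((hcont 0 ⟨le_rfl, ht.le⟩).mono Set.Ioc_subset_Icc_self).tendsto.mono_left ?_
    rw [nhdsWithin_Ioc_eq_nhdsGT ht]
  have hlim' : Tendsto (fun s => P s (u s)) (𝓝[>] 0) (𝓝 (P t (u t))) := by
    refine tendsto_const_nhds.congr' ?_
    filter_upwards [Ioc_mem_nhdsGT ht] with s hs0 using (hconst s hs0).symm
  have heq := tendsto_nhds_unique hlim hlim'
  have e1 : P t (u t) = fourierPairing N p (compactSchwartz χ) (u t) := by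
    simp only [hP, sub_self]
    exact (isFourierRelated_expSymbol_zero (b := b) (u t) χ hc hs).symm
  rw [← e1, ← heq, hu.initial]
  simp [hP]

end Realization

/-! ### The semigroup generated by the maximal realization -/

section Semigroup

variable {n N : ℕ} {p : ℝ≥0∞} [Fact (1 ≤ p)]
  {a b : EuclideanSpace ℝ (Fin n) → Matrix (Fin N) (Fin N) ℂ}
  {S : ℝ≥0 → LpSpace n N p →L[ℂ] LpSpace n N p}

/-- Since `h` has compact support, `t ↦ e^{tb} h` is differentiable as a curve in the Schwartz
space, and `𝓕⁻` followed by the embedding into `L^p` is continuous. -/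
theorem continuous_ofFourier_expSymbol (hb : IsSmoothSymbol b)
    {h : EuclideanSpace ℝ (Fin n) → EuclideanSpace ℂ (Fin N)} (hc : HasCompactSupport h)
    (hs : ContDiff ℝ ∞ h) :
    Continuous fun t : ℝ => ofFourier p (applySymbol (expSymbol b t) h) := by
  set L : 𝓢(EuclideanSpace ℝ (Fin n), EuclideanSpace ℂ (Fin N)) →L[ℂ] LpSpace n N p :=
    SchwartzMap.toLpCLM ℂ (EuclideanSpace ℂ (Fin N)) p volume ∘L
      FourierTransform.fourierInvCLM ℂ 𝓢(EuclideanSpace ℝ (Fin n), EuclideanSpace ℂ (Fin N))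
  have hg : ContDiff ℝ ∞ (fun z : ℝ × EuclideanSpace ℝ (Fin n) =>
      applySymbol (expSymbol b z.1) h z.2) := by
    refine (contDiff_piLp 2).2 fun i => ?_
    simp only [applySymbol_apply]
    exact ContDiff.sum fun j _ => (contDiff_expSymbol hb i j).mul
      (((contDiff_piLp 2).1 hs j).comp contDiff_snd)
  have hsupp : ∀ t, tsupport (fun x => applySymbol (expSymbol b t) h x) ⊆ tsupport h := by
    intro t
    refine closure_mono fun ξ hξ h0 => hξ ?_
    simp [applySymbol, h0]
  exact continuous_iff_continuousAt.2 fun t =>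
    (hasDerivAt_compactSchwartz L hg hc hsupp t).continuousAt

/-- The algebraic laws follow from those of `e^{tb}` because the relation determines its second
member. Orbits are locally uniform limits of the continuous orbits of a dense set. -/
theorem IsC0Semigroup.of_isFourierRelated (hp : p ≠ ⊤) (hb : IsSmoothSymbol b)
    (hS : ∀ t u, IsFourierRelated (expSymbol b (t : ℝ≥0)) u (S t u))
    (hbdd : ∀ T : ℝ≥0, ∃ C : ℝ, ∀ t ≤ T, ‖S t‖ ≤ C) : IsC0Semigroup S where
  map_zero := by
    ext1 u
    exact (hS 0 u).unique (isFourierRelated_expSymbol_zero u)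
  map_add s t := by
    ext1 u
    have h := (hS t u).trans (hS s (S t u)) (hb.expSymbol t) (hb.expSymbol s)
    simp only [← expSymbol_add, ← NNReal.coe_add] at h
    exact (hS (s + t) u).unique h
  continuous_orbit u := by
    refine continuous_of_locally_uniform_approx_of_continuousAt fun t U hU => ?_
    obtain ⟨ε, hε, hεU⟩ := Metric.mem_uniformity_dist.1 hU
    obtain ⟨C, hC⟩ := hbdd (t + 1)
    have hC0 : 0 ≤ C := (norm_nonneg _).trans (hC t (by simp))
    obtain ⟨_, hw, h, hc, hs, rfl⟩ := Metric.dense_iff.1 (dense_range_ofFourier hp) u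
      -- The added `1` covers the case `C = 0` and keeps the final inequality strict.
      (ε / (C + 1)) (by positivity)
    refine ⟨Set.Iio (t + 1), Iio_mem_nhds (by simp),
      fun s => ofFourier p (applySymbol (expSymbol b s) h), ?_, fun s hs' => hεU ?_⟩
    · exact ((continuous_ofFourier_expSymbol hb hc hs).comp NNReal.continuous_coe).continuousAt
    · have heq : S s (ofFourier p h) = ofFourier p (applySymbol (expSymbol b s) h) :=
        (hS s _).unique (isFourierRelated_ofFourier hc hs (hb.expSymbol s))
      change dist (S s u) (ofFourier p (applySymbol (expSymbol b s) h)) < ε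
      rw [← heq, dist_eq_norm, ← map_sub]
      rw [Metric.mem_ball, dist_comm, dist_eq_norm] at hw
      calc ‖S s (u - ofFourier p h)‖ ≤ C * ‖u - ofFourier p h‖ :=
            (S s).le_of_opNorm_le (hC s (le_of_lt hs')) _
        _ ≤ C * (ε / (C + 1)) := by gcongr
        _ < ε := by
            rw [mul_div_assoc', div_lt_iff₀ (by positivity)]
            nlinarith

theorem IsC0Semigroup.continuous_real (hC0 : IsC0Semigroup S) (v : LpSpace n N p) :
    Continuous fun s : ℝ => S s.toNNReal v :=
  (hC0.continuous_orbit v).comp continuous_real_toNNReal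

theorem IsC0Semigroup.hasDerivAt_integral (hC0 : IsC0Semigroup S) (u v : LpSpace n N p) (t : ℝ) :
    HasDerivAt (fun t : ℝ => u + ∫ s in (0 : ℝ)..t, S s.toNNReal v) (S t.toNNReal v) t :=
  ((hC0.continuous_real v).integral_hasStrictDerivAt 0 t).hasDerivAt.const_add u

/-- Tested against `χ`, it is the fundamental theorem of calculus: the derivative of `e^{sa} û` is
`e^{sa} a û = e^{sa} v̂`, the Fourier transform of `S(s)v`. -/
theorem orbit_eq_add_integral
    (hS : ∀ t u, IsFourierRelated (expSymbol (dilatedSymbol a) (t : ℝ≥0)) u (S t u))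
    (ha : ∀ i j, (fun ξ => dilatedSymbol a ξ i j).HasTemperateGrowth) (hC0 : IsC0Semigroup S)
    {u v : LpSpace n N p} (huv : (u, v) ∈ (maximalRealization p a).graph)
    {t : ℝ} (ht : 0 ≤ t) :
    S t.toNNReal u = u + ∫ s in (0 : ℝ)..t, S s.toNNReal v := by
  have hb : IsSmoothSymbol (dilatedSymbol a) := fun i j => (ha i j).1
  have huv' := (mem_graph_iff_isFourierRelated ha).1 huv
  have h1 := hS t.toNNReal u
  rw [Real.coe_toNNReal t ht] at h1
  refine h1.unique fun χ hc hs => ?_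
  have hcont : Continuous fun s : ℝ => fourierPairing N p (compactSchwartz χ) (S s.toNNReal v) :=
    (fourierPairing N p (compactSchwartz χ)).continuous.comp (hC0.continuous_real v)
  have hFTC : ∫ s in (0 : ℝ)..t, fourierPairing N p (compactSchwartz χ) (S s.toNNReal v) =
      symbolPairing p (expSymbol (dilatedSymbol a) t) χ u -
        symbolPairing p (expSymbol (dilatedSymbol a) 0) χ u := by
    refine intervalIntegral.integral_eq_sub_of_hasDerivAt
      (f := fun s => symbolPairing p (expSymbol (dilatedSymbol a) s) χ u) (fun s hs' => ?_)
      (hcont.intervalIntegrable 0 t)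
    rw [Set.uIcc_of_le ht] at hs'
    have h2 := huv'.trans (hS s.toNNReal v) hb (hb.expSymbol _)
    rw [Real.coe_toNNReal s hs'.1] at h2
    rw [h2 χ hc hs]
    exact ((ContinuousLinearMap.apply ℂ (EuclideanSpace ℂ (Fin N)) u).restrictScalars
        ℝ).hasFDerivAt.comp_hasDerivAt s (hasDerivAt_symbolPairing_expSymbol hb hc hs s)
  have hcomm : ∫ s in (0 : ℝ)..t, fourierPairing N p (compactSchwartz χ) (S s.toNNReal v) =
      fourierPairing N p (compactSchwartz χ) (∫ s in (0 : ℝ)..t, S s.toNNReal v) :=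
    ContinuousLinearMap.intervalIntegral_comp_comm (𝕜 := ℂ) _
      ((hC0.continuous_real v).intervalIntegrable 0 t)
  rw [map_add, ← hcomm, hFTC, isFourierRelated_expSymbol_zero u χ hc hs]
  abel

/-- For `u` in the domain, differentiate the integral formula at `0`. Conversely, if the difference
quotients converge to `v`, their tested Fourier transforms converge both to that of `v` and to `a
û`, so `v̂ = a û`. -/
theorem isGeneratorOf_maximalRealization
    (hS : ∀ t u, IsFourierRelated (expSymbol (dilatedSymbol a) (t : ℝ≥0)) u (S t u))
    (ha : ∀ i j, (fun ξ => dilatedSymbol a ξ i j).HasTemperateGrowth) (hC0 : IsC0Semigroup S) :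
    IsGeneratorOf (maximalRealization p a) S := by
  have hb : IsSmoothSymbol (dilatedSymbol a) := fun i j => (ha i j).1
  have hcoe : Tendsto (fun h : ℝ≥0 => (h : ℝ)) (𝓝[>] 0) (𝓝[≠] 0) := by
    refine tendsto_nhdsWithin_iff.2 ⟨?_, ?_⟩
    · exact (NNReal.continuous_coe.tendsto' 0 0 rfl).mono_left nhdsWithin_le_nhds
    · filter_upwards [self_mem_nhdsWithin] with h hh
      exact (NNReal.coe_pos.2 hh).ne'
  intro u v
  constructor
  · intro huv
    have h1 := hasDerivAt_iff_tendsto_slope_zero.1 (hC0.hasDerivAt_integral u v 0)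
    have h2 := h1.comp hcoe
    rw [Real.toNNReal_zero, hC0.map_zero] at h2
    refine h2.congr fun h => ?_
    have h3 := orbit_eq_add_integral hS ha hC0 huv h.coe_nonneg
    rw [Real.toNNReal_coe] at h3
    simp only [Function.comp_apply, zero_add, h3, intervalIntegral.integral_same, add_zero]
    rfl
  · intro hlim
    refine (mem_graph_iff_isFourierRelated ha).2 fun χ hc hs => ?_
    have h1 := ((fourierPairing N p (compactSchwartz χ)).continuous.tendsto v).comp hlim
    have h2 : HasDerivAt (fun s => symbolPairing p (expSymbol (dilatedSymbol a) s) χ u)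
        (symbolPairing p (fun ξ => expSymbol (dilatedSymbol a) 0 ξ * dilatedSymbol a ξ) χ u) 0 :=
      ((ContinuousLinearMap.apply ℂ (EuclideanSpace ℂ (Fin N)) u).restrictScalars
        ℝ).hasFDerivAt.comp_hasDerivAt 0 (hasDerivAt_symbolPairing_expSymbol hb hc hs 0)
    simp only [expSymbol_zero, one_mul] at h2
    have h3 := (hasDerivAt_iff_tendsto_slope_zero.1 h2).comp hcoe
    refine tendsto_nhds_unique (h1.congr fun h => ?_) h3
    have h4 := ((fourierPairing N p (compactSchwartz χ)).restrictScalars ℝ).map_smul (h : ℝ)⁻¹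
      (S h u - u)
    simp only [ContinuousLinearMap.coe_restrictScalars'] at h4
    simp only [Function.comp_apply, zero_add]
    refine h4.trans ?_
    rw [map_sub, hS h u χ hc hs, isFourierRelated_expSymbol_zero u χ hc hs]

/-- The matrices `a(ξ)` and `e^{ta(ξ)}` commute. -/
theorem orbit_mem_graph
    (hS : ∀ t u, IsFourierRelated (expSymbol (dilatedSymbol a) (t : ℝ≥0)) u (S t u))
    (ha : ∀ i j, (fun ξ => dilatedSymbol a ξ i j).HasTemperateGrowth)
    {u v : LpSpace n N p} (huv : (u, v) ∈ (maximalRealization p a).graph)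
    (t : ℝ≥0) : (S t u, S t v) ∈ (maximalRealization p a).graph := by
  have hb : IsSmoothSymbol (dilatedSymbol a) := fun i j => (ha i j).1
  rw [mem_graph_iff_isFourierRelated ha] at huv ⊢
  intro χ hc hs
  rw [huv.trans (hS t v) hb (hb.expSymbol _) χ hc hs,
    (hS t u).symbolPairing_eq (hb.expSymbol _) hb hc hs]
  simp only [expSymbol_mul_comm]

theorem isWellPosed_maximalRealization
    (hS : ∀ t u, IsFourierRelated (expSymbol (dilatedSymbol a) (t : ℝ≥0)) u (S t u))
    (ha : ∀ i j, (fun ξ => dilatedSymbol a ξ i j).HasTemperateGrowth) (hC0 : IsC0Semigroup S)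
    (hbdd : ∀ T : ℝ≥0, ∃ C : ℝ, ∀ t ≤ T, ‖S t‖ ≤ C) :
    IsWellPosed (maximalRealization p a) where
  exists_solution u₀ hu₀ := by
    have huv := LinearPMap.mem_graph (maximalRealization p a) ⟨u₀, hu₀⟩
    set v := maximalRealization p a ⟨u₀, hu₀⟩
    -- The integral formula is taken as the definition of the solution: it is `C¹` on all of `ℝ`
    -- because its integrand is continuous there, and it agrees with the orbit for `t ≥ 0`.
    refine ⟨fun t => u₀ + ∫ s in (0 : ℝ)..t, S s.toNNReal v, ?_, by simp, fun t ht => ?_⟩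
    · have hd := hC0.hasDerivAt_integral u₀ v
      refine (contDiff_one_iff_deriv.2 ⟨fun t => (hd t).differentiableAt, ?_⟩).contDiffOn
      rw [funext fun t => (hd t).deriv]
      exact hC0.continuous_real v
    · rw [← orbit_eq_add_integral hS ha hC0 huv ht.le]
      obtain ⟨hdom, heq⟩ := LinearPMap.mem_domain_of_mem_graph'
        (orbit_mem_graph hS ha huv t.toNNReal)
      refine ⟨hdom, ?_⟩
      rw [heq]
      exact hC0.hasDerivAt_integral u₀ v t
  unique_solution u₀ _ u v hu hv t ht :=
    (hu.isFourierRelated ha ht).unique (hv.isFourierRelated ha ht)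
  bound T hT := by
    obtain ⟨C, hC⟩ := hbdd T.toNNReal
    refine ⟨max C 1, by positivity, fun u₀ _ u hu t ht => ?_⟩
    have h1 := hS t.toNNReal u₀
    rw [Real.coe_toNNReal t ht.1] at h1
    rw [(hu.isFourierRelated ha ht.1).unique h1]
    exact (S _).le_of_opNorm_le ((hC _ (Real.toNNReal_le_toNNReal ht.2)).trans (le_max_left _ _)) _

end Semigroup

/-! ### Multiplier bounds on functions with compactly supported Fourier transform -/

section Bounds

variable {n N : ℕ} {p : ℝ≥0∞} {m : EuclideanSpace ℝ (Fin n) → Matrix (Fin N) (Fin N) ℂ} {C : ℝ}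

/-- `‖ℱ⁻¹(m h)‖_p ≤ C ‖ℱ⁻¹ h‖_p` for all smooth `h` with compact support. -/
def HasCompactFourierBound (p : ℝ≥0∞) (m : EuclideanSpace ℝ (Fin n) → Matrix (Fin N) (Fin N) ℂ)
    (C : ℝ) : Prop :=
  ∀ h : EuclideanSpace ℝ (Fin n) → EuclideanSpace ℂ (Fin N), HasCompactSupport h →
    ContDiff ℝ ∞ h → eLpNorm (𝓕⁻ (applySymbol m h)) p volume ≤
      ENNReal.ofReal C * eLpNorm (𝓕⁻ h) p volume

theorem fourierInv_comp_affine {V : Type*} [NormedAddCommGroup V] [NormedSpace ℂ V]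
    (g : EuclideanSpace ℝ (Fin n) → V) {r : ℝ} (hr : r ≠ 0) (ξ₀ x : EuclideanSpace ℝ (Fin n)) :
    𝓕⁻ (fun ξ => g (r⁻¹ • (ξ - ξ₀))) x =
      Complex.exp ((2 * Real.pi * inner ℝ ξ₀ x : ℝ) * Complex.I) • |r ^ n| • 𝓕⁻ g (r • x) := by
  have h1 := integral_sub_right_eq_self (μ := (volume : Measure (EuclideanSpace ℝ (Fin n))))
    (fun ξ : EuclideanSpace ℝ (Fin n) =>
      Complex.exp ((2 * Real.pi * inner ℝ (ξ + ξ₀) x : ℝ) * Complex.I) • g (r⁻¹ • ξ)) ξ₀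
  have h2 := Measure.integral_comp_inv_smul (volume : Measure (EuclideanSpace ℝ (Fin n)))
    (fun η : EuclideanSpace ℝ (Fin n) =>
      Complex.exp ((2 * Real.pi * inner ℝ (r • η + ξ₀) x : ℝ) * Complex.I) • g η) r
  simp only [smul_inv_smul₀ hr, finrank_euclideanSpace, Fintype.card_fin] at h2
  simp only [sub_add_cancel] at h1
  rw [Real.fourierInv_eq', Real.fourierInv_eq', h1, h2, smul_comm _ (|r ^ n|),
    ← integral_smul (Complex.exp ((2 * Real.pi * inner ℝ ξ₀ x : ℝ) * Complex.I))]
  refine congrArg (fun v : V => |r ^ n| • v) (integral_congr_ae (ae_of_all _ fun η => ?_))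
  dsimp only
  rw [smul_smul, ← Complex.exp_add, inner_add_left, real_inner_smul_left, real_inner_smul_right]
  congr 2
  push_cast
  ring

theorem eLpNorm_comp_smul {V : Type*} [NormedAddCommGroup V] (hp : p ≠ ⊤)
    (f : EuclideanSpace ℝ (Fin n) → V) {r : ℝ} (hr : r ≠ 0) :
    eLpNorm (fun x => f (r • x)) p volume =
      ENNReal.ofReal |(r ^ n)⁻¹| ^ (1 / p).toReal * eLpNorm f p volume := by
  have h := (Homeomorph.smulOfNeZero r hr).measurableEmbedding.eLpNorm_map_measure (p := p) (g := f)
    (μ := (volume : Measure (EuclideanSpace ℝ (Fin n))))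
  have h2 := Measure.map_addHaar_smul (volume : Measure (EuclideanSpace ℝ (Fin n))) hr
  rw [finrank_euclideanSpace, Fintype.card_fin] at h2
  change eLpNorm f p (Measure.map (fun x => r • x) volume) = _ at h
  rw [h2, eLpNorm_smul_measure_of_ne_top hp, smul_eq_mul] at h
  exact h.symm

/-- An affine change of frequency is a modulation and a dilation in space. Only a finite nonzero
factor independent of `g` matters, as it cancels from multiplier inequalities. -/
theorem exists_eLpNorm_fourierInv_comp_affine {V : Type*} [NormedAddCommGroup V] [NormedSpace ℂ V]
    (hp : p ≠ ⊤) {r : ℝ} (hr : r ≠ 0) (ξ₀ : EuclideanSpace ℝ (Fin n)) :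
    ∃ c : ℝ≥0∞, c ≠ 0 ∧ c ≠ ⊤ ∧ ∀ g : EuclideanSpace ℝ (Fin n) → V,
      eLpNorm (𝓕⁻ (fun ξ => g (r⁻¹ • (ξ - ξ₀)))) p volume = c * eLpNorm (𝓕⁻ g) p volume := by
  have hrn : r ^ n ≠ 0 := pow_ne_zero n hr
  have h1 : ENNReal.ofReal |(r ^ n)⁻¹| ≠ 0 := by simp [hr]
  refine ⟨‖|r ^ n|‖ₑ * ENNReal.ofReal |(r ^ n)⁻¹| ^ (1 / p).toReal, mul_ne_zero ?_ ?_,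
    ENNReal.mul_ne_top enorm_ne_top ?_, fun g => ?_⟩
  · simp [hr]
  · exact (ENNReal.rpow_pos (pos_iff_ne_zero.2 h1) ENNReal.ofReal_ne_top).ne'
  · exact ENNReal.rpow_ne_top_of_nonneg ENNReal.toReal_nonneg ENNReal.ofReal_ne_top
  · rw [mul_assoc, ← eLpNorm_comp_smul hp (𝓕⁻ g) hr, ← eLpNorm_const_smul]
    refine eLpNorm_congr_norm_ae (ae_of_all _ fun x => ?_)
    rw [fourierInv_comp_affine g hr, norm_smul, Complex.norm_exp_ofReal_mul_I, one_mul]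
    rfl

theorem HasCompactFourierBound.comp_affine (hp : p ≠ ⊤) (hm : HasCompactFourierBound p m C)
    {r : ℝ} (hr : r ≠ 0) (ξ₀ : EuclideanSpace ℝ (Fin n)) :
    HasCompactFourierBound p (fun ξ => m (ξ₀ + r • ξ)) C := by
  intro h hc hs
  obtain ⟨c, hc0, hct, hcg⟩ :=
    exists_eLpNorm_fourierInv_comp_affine (V := EuclideanSpace ℂ (Fin N)) hp hr ξ₀
  have h1 := hm (fun ξ => h (r⁻¹ • (ξ - ξ₀)))
    (hc.comp_homeomorph
      ((Homeomorph.subRight ξ₀).trans (Homeomorph.smulOfNeZero r⁻¹ (inv_ne_zero hr))))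
    (hs.comp (by fun_prop))
  have h2 : applySymbol m (fun ξ => h (r⁻¹ • (ξ - ξ₀))) =
      fun ξ => applySymbol (fun ξ => m (ξ₀ + r • ξ)) h (r⁻¹ • (ξ - ξ₀)) := by
    ext1 ξ
    simp [applySymbol, smul_inv_smul₀ hr]
  rw [h2, hcg, hcg, mul_left_comm] at h1
  exact (ENNReal.mul_le_mul_iff_right hc0 hct).1 h1

theorem continuous_fourierInv_of_integrable {V : Type*} [NormedAddCommGroup V] [NormedSpace ℂ V]
    {f : EuclideanSpace ℝ (Fin n) → V} (hf : Integrable f) : Continuous (𝓕⁻ f) :=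
  VectorFourier.fourierIntegral_continuous Real.continuous_fourierChar
    (continuous_inner (𝕜 := ℝ) (E := EuclideanSpace ℝ (Fin n))).neg hf

/-- Zooming in at `ξ₀`, the symbols `m(ξ₀ + r ξ)` have the same bound `C` for every `r ≠ 0` and tend
to the constant `m(ξ₀)` as `r → 0`; Fatou's lemma carries the bound to the limit. -/
theorem HasCompactFourierBound.const (hp : p ≠ ⊤) (hms : IsSmoothSymbol m)
    (hm : HasCompactFourierBound p m C) (ξ₀ : EuclideanSpace ℝ (Fin n)) :
    HasCompactFourierBound p (fun _ : EuclideanSpace ℝ (Fin n) => m ξ₀) C := by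
  intro h hc hs
  have hsm : ∀ r : ℝ, IsSmoothSymbol fun ξ => m (ξ₀ + r • ξ) := fun r i j =>
    (hms i j).comp (by fun_prop)
  have hlim : ∀ x, Tendsto (fun k : ℕ => 𝓕⁻ (applySymbol
      (fun ξ => m (ξ₀ + ((k : ℝ) + 1)⁻¹ • ξ)) h) x) atTop
      (𝓝 (𝓕⁻ (applySymbol (fun _ : EuclideanSpace ℝ (Fin n) => m ξ₀) h) x)) := by
    intro x
    -- Over the compact set `tsupport h` the integral is continuous in `r`, including at `r = 0`.
    have hcont : Continuous fun r : ℝ => ∫ ξ in tsupport h,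
        Complex.exp ((2 * Real.pi * inner ℝ ξ x : ℝ) * Complex.I) •
          applySymbol (fun ξ => m (ξ₀ + r • ξ)) h ξ := by
      refine continuous_parametric_integral_of_continuous ?_ hc
      have h2 : Continuous fun z : ℝ × EuclideanSpace ℝ (Fin n) =>
          applySymbol (fun ξ => m (ξ₀ + z.1 • ξ)) h z.2 := by
        refine ContDiff.continuous (𝕜 := ℝ) (n := ∞) ((contDiff_piLp 2).2 fun i => ?_)
        simp only [applySymbol_apply]
        exact ContDiff.sum fun j _ => ((hms i j).comp (contDiff_const.add
          (contDiff_fst.smul contDiff_snd))).mul (((contDiff_piLp 2).1 hs j).comp contDiff_snd)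
      exact ((Complex.continuous_ofReal.comp (continuous_const.mul
        (continuous_snd.inner continuous_const))).mul continuous_const).cexp.smul h2
    have heq : ∀ r : ℝ, ∫ ξ in tsupport h,
        Complex.exp ((2 * Real.pi * inner ℝ ξ x : ℝ) * Complex.I) •
          applySymbol (fun ξ => m (ξ₀ + r • ξ)) h ξ =
        𝓕⁻ (applySymbol (fun ξ => m (ξ₀ + r • ξ)) h) x := by
      intro r
      rw [Real.fourierInv_eq']
      refine setIntegral_eq_integral_of_forall_compl_eq_zero fun ξ hξ => ?_
      rw [applySymbol, image_eq_zero_of_notMem_tsupport hξ, map_zero, smul_zero]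
    have h0 : Tendsto (fun k : ℕ => ((k : ℝ) + 1)⁻¹) atTop (𝓝 0) := by
      simpa using tendsto_one_div_add_atTop_nhds_zero_nat (𝕜 := ℝ)
    have h1 := (hcont.tendsto 0).comp h0
    simp only [heq, Function.comp_def] at h1
    simpa using h1
  refine (Lp.eLpNorm_lim_le_liminf_eLpNorm (fun k => ?_) _ (ae_of_all _ hlim)).trans ?_
  · exact (continuous_fourierInv_of_integrable (((hsm _).applySymbol
      hs).continuous.integrable_of_hasCompactSupport hc.applySymbol)).aestronglyMeasurable
  · refine (liminf_le_liminf (Eventually.of_forall fun k : ℕ =>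
      hm.comp_affine hp (r := ((k : ℝ) + 1)⁻¹) (by positivity) ξ₀ h hc hs)).trans ?_
    rw [liminf_const]

/-- A constant matrix acts on `(𝓕⁻ ρ) • v` through `v` alone, so the norm of `𝓕⁻ ρ`, which is finite
and nonzero for a bump `ρ`, cancels. -/
theorem HasCompactFourierBound.norm_le (hp : p ≠ ⊤) (hp1 : 1 ≤ p) (hC : 0 ≤ C)
    (hms : IsSmoothSymbol m)
    (hm : HasCompactFourierBound p m C) (ξ₀ : EuclideanSpace ℝ (Fin n))
    (v : EuclideanSpace ℂ (Fin N)) :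
    ‖Matrix.toEuclideanCLM (n := Fin N) (𝕜 := ℂ) (m ξ₀) v‖ ≤ C * ‖v‖ := by
  set T := Matrix.toEuclideanCLM (n := Fin N) (𝕜 := ℂ) (m ξ₀)
  set B : ContDiffBump (0 : EuclideanSpace ℝ (Fin n)) := ⟨1, 2, one_pos, one_lt_two⟩
  set ρ : EuclideanSpace ℝ (Fin n) → ℂ := fun ξ => (B ξ : ℂ) with hρ
  have hρc : HasCompactSupport ρ := B.hasCompactSupport.comp_left Complex.ofReal_zero
  have hρs : ContDiff ℝ ∞ ρ := Complex.ofRealCLM.contDiff.comp B.contDiff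
  have hF : ∀ (w : EuclideanSpace ℂ (Fin N)),
      eLpNorm (𝓕⁻ (fun ξ => ρ ξ • w)) p volume = ‖w‖ₑ * eLpNorm (𝓕⁻ ρ) p volume := by
    intro w
    have h1 : ∀ x, 𝓕⁻ (fun ξ => ρ ξ • w) x = 𝓕⁻ ρ x • w := by
      intro x
      rw [Real.fourierInv_eq', Real.fourierInv_eq', ← integral_smul_const]
      simp only [smul_smul, smul_eq_mul]
    have h2 := eLpNorm_const_smul (‖w‖ : ℂ) (𝓕⁻ ρ) p volume
    have h3 : ‖(‖w‖ : ℂ)‖ₑ = ‖w‖ₑ := by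
      rw [← ofReal_norm, Complex.norm_real, norm_norm, ofReal_norm]
    rw [← h3, ← h2]
    refine eLpNorm_congr_norm_ae (ae_of_all _ fun x => ?_)
    rw [h1, norm_smul, mul_comm, Pi.smul_apply, norm_smul, Complex.norm_real, norm_norm]
  have h1 := hm.const hp hms ξ₀ (fun ξ => ρ ξ • v) hρc.smul_right (hρs.smul contDiff_const)
  have h2 : applySymbol (fun _ : EuclideanSpace ℝ (Fin n) => m ξ₀) (fun ξ => ρ ξ • v) = fun ξ => ρ ξ • T v := by
    ext1 ξ
    exact map_smul T _ _
  rw [h2, hF, hF, ← mul_assoc] at h1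
  have : Fact (1 ≤ p) := ⟨hp1⟩
  have h3 : (𝓕⁻ ρ) = 𝓕⁻ (compactSchwartz ρ) := by
    rw [SchwartzMap.fourierInv_coe, coe_compactSchwartz hρc hρs]
  have h4 : eLpNorm (𝓕⁻ ρ) p volume ≠ ⊤ := by
    rw [h3]
    exact ((𝓕⁻ (compactSchwartz ρ)).memLp p volume).2.ne
  have h5 : eLpNorm (𝓕⁻ ρ) p volume ≠ 0 := by
    rw [h3]
    intro h0
    have h6 : ‖(𝓕⁻ (compactSchwartz ρ)).toLp p volume‖ = 0 := by
      rw [SchwartzMap.norm_toLp, h0, ENNReal.toReal_zero]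
    have h7 : 𝓕⁻ (compactSchwartz ρ) = 0 :=
      SchwartzMap.injective_toLp p volume (by
        change (𝓕⁻ (compactSchwartz ρ)).toLp p volume =
          (0 : 𝓢(EuclideanSpace ℝ (Fin n), ℂ)).toLp p volume
        rw [norm_eq_zero.1 h6]
        exact (map_zero (SchwartzMap.toLpCLM ℂ ℂ p volume)).symm)
    have h8 : compactSchwartz ρ = 0 := by
      have h8 := FourierTransform.fourier_fourierInv_eq
        (F := 𝓢(EuclideanSpace ℝ (Fin n), ℂ)) (compactSchwartz ρ)
      rw [h7] at h8
      exact h8.symm.trans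
        (map_zero (FourierTransform.fourierCLM ℂ 𝓢(EuclideanSpace ℝ (Fin n), ℂ)))
    have h9 : ρ 0 = 0 := by
      rw [← coe_compactSchwartz hρc hρs, h8]
      rfl
    have h10 : B 0 = 1 := B.one_of_mem_closedBall (by simp [B])
    simp [hρ, h10] at h9
  have h6 := (ENNReal.mul_le_mul_iff_left h5 h4).1 h1
  rw [← ofReal_norm, ← ofReal_norm, ← ENNReal.ofReal_mul hC] at h6
  exact (ENNReal.ofReal_le_ofReal_iff (by positivity)).1 h6

end Bounds

/-! ### From bounds on a dense set to Fourier multipliers -/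

section Multipliers

variable {n N : ℕ} {p : ℝ≥0∞} {a m : EuclideanSpace ℝ (Fin n) → Matrix (Fin N) (Fin N) ℂ} {C : ℝ}

theorem HasCompactFourierBound.memLp_top (hp : p ≠ ⊤) (hp1 : 1 ≤ p) (hC : 0 ≤ C)
    (hms : IsSmoothSymbol m) (hm : HasCompactFourierBound p (dilatedSymbol m) C) (i j : Fin N) :
    MemLp (fun ξ => m ξ i j) ⊤ volume := by
  have hds : IsSmoothSymbol (dilatedSymbol m) := fun i j =>
    (hms i j).comp (contDiff_const_smul (-(2 * Real.pi)))
  refine memLp_top_of_bound (hms i j).continuous.aestronglyMeasurable C (ae_of_all _ fun ξ => ?_)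
  have h1 := hm.norm_le hp hp1 hC hds ((-(2 * Real.pi))⁻¹ • ξ) (EuclideanSpace.single j 1)
  rw [dilatedSymbol, smul_inv_smul₀ (by simp [Real.pi_ne_zero])] at h1
  have h2 : Matrix.toEuclideanCLM (n := Fin N) (𝕜 := ℂ) (m ξ) (EuclideanSpace.single j 1) i =
      m ξ i j := by
    change (m ξ).mulVec (EuclideanSpace.single j (1 : ℂ)).ofLp i = _
    simp
  rw [← h2]
  refine (PiLp.norm_apply_le _ i).trans (h1.trans ?_)
  simp

/-- Approximate `𝓕 φ` by compactly supported `h k` in the Schwartz space. By the pointwise bound on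
the symbol, convergence in `L¹` yields pointwise convergence of the inverse transforms; Fatou's
lemma and convergence of the norms of `𝓕⁻ (h k)` finish. -/
theorem HasCompactFourierBound.eLpNorm_opSchwartz_le (hp : p ≠ ⊤) (hp1 : 1 ≤ p) (hC : 0 ≤ C)
    (hms : IsSmoothSymbol m) (hm : HasCompactFourierBound p (dilatedSymbol m) C)
    (φ : 𝓢(EuclideanSpace ℝ (Fin n), EuclideanSpace ℂ (Fin N))) :
    eLpNorm (opSchwartz m φ) p volume ≤ ENNReal.ofReal C * eLpNorm φ p volume := by
  have : Fact (1 ≤ p) := ⟨hp1⟩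
  have hds : IsSmoothSymbol (dilatedSymbol m) := fun i j =>
    (hms i j).comp (contDiff_const_smul (-(2 * Real.pi)))
  obtain ⟨h, hc, hs, hlim⟩ := SchwartzMap.exists_tendsto_compactSchwartz (𝓕 φ)
  set g := 𝓕 φ with hg
  have hint : ∀ k, Integrable (applySymbol (dilatedSymbol m) (h k)) := fun k =>
    (hds.applySymbol (hs k)).continuous.integrable_of_hasCompactSupport (hc k).applySymbol
  have hint' := integrable_symbol_mul_fourier
    (fun i j => hm.memLp_top hp hp1 hC hms i j) φ
  have hL1 : Tendsto (fun k => eLpNorm (h k - ⇑g) 1 volume) atTop (𝓝 0) := by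
    have h1 := ((SchwartzMap.toLpCLM ℂ (EuclideanSpace ℂ (Fin N)) 1
      (volume : Measure (EuclideanSpace ℝ (Fin n)))).continuous.tendsto g).comp hlim
    refine ((Lp.tendsto_Lp_iff_tendsto_eLpNorm' _ _).1 h1).congr fun k => ?_
    refine eLpNorm_congr_ae ?_
    filter_upwards [(compactSchwartz (h k)).coeFn_toLp 1 volume, g.coeFn_toLp 1 volume]
      with x hx hx'
    change (compactSchwartz (h k)).toLp 1 volume x - g.toLp 1 volume x = _
    rw [hx, hx', coe_compactSchwartz (hc k) (hs k)]
    rfl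
  have hpt : ∀ x, Tendsto (fun k => 𝓕⁻ (applySymbol (dilatedSymbol m) (h k)) x) atTop
      (𝓝 (opSchwartz m φ x)) := by
    intro x
    simp only [opSchwartz, Real.fourierInv_eq']
    have hexp : Continuous fun ξ : EuclideanSpace ℝ (Fin n) =>
        Complex.exp ((2 * Real.pi * inner ℝ ξ x : ℝ) * Complex.I) :=
      ((Complex.continuous_ofReal.comp (continuous_const.mul
        (continuous_id.inner continuous_const))).mul continuous_const).cexp
    have hi : ∀ {f : EuclideanSpace ℝ (Fin n) → EuclideanSpace ℂ (Fin N)}, Integrable f →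
        Integrable fun ξ => Complex.exp ((2 * Real.pi * inner ℝ ξ x : ℝ) * Complex.I) • f ξ :=
      fun hf => hf.bdd_smul (C := 1) hexp.aestronglyMeasurable
        (ae_of_all _ fun ξ => (Complex.norm_exp_ofReal_mul_I _).le)
    refine tendsto_integral_of_L1' _ (hi hint').aestronglyMeasurable
      (Eventually.of_forall fun k => hi (hint k)) ?_
    have h0 : Tendsto (fun k => ENNReal.ofReal C * eLpNorm (h k - ⇑g) 1 volume) atTop
        (𝓝 0) := by
      simpa using ENNReal.Tendsto.const_mul hL1 (Or.inr ENNReal.ofReal_ne_top)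
    refine tendsto_of_tendsto_of_tendsto_of_le_of_le tendsto_const_nhds h0 (fun _ => zero_le)
      fun k => eLpNorm_le_mul_eLpNorm_of_ae_le_mul (ae_of_all _ fun ξ => ?_) 1
    have h1 := hm.norm_le hp hp1 hC hds ξ (h k ξ - g ξ)
    rw [map_sub] at h1
    rw [Pi.sub_apply, ← smul_sub, norm_smul, Complex.norm_exp_ofReal_mul_I, one_mul]
    exact h1
  have hnorm : Tendsto (fun k => eLpNorm (𝓕⁻ (h k)) p volume) atTop (𝓝 (eLpNorm φ p volume)) := by
    have h1 := (((SchwartzMap.toLpCLM ℂ (EuclideanSpace ℂ (Fin N)) p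
      (volume : Measure (EuclideanSpace ℝ (Fin n)))) ∘L
      FourierTransform.fourierInvCLM ℂ
        𝓢(EuclideanSpace ℝ (Fin n), EuclideanSpace ℂ (Fin N))).continuous.enorm.tendsto
        g).comp hlim
    have h2 : ∀ ψ : 𝓢(EuclideanSpace ℝ (Fin n), EuclideanSpace ℂ (Fin N)),
        ‖((SchwartzMap.toLpCLM ℂ (EuclideanSpace ℂ (Fin N)) p
          (volume : Measure (EuclideanSpace ℝ (Fin n)))) ∘L
          FourierTransform.fourierInvCLM ℂ
            𝓢(EuclideanSpace ℝ (Fin n), EuclideanSpace ℂ (Fin N))) ψ‖ₑ =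
          eLpNorm (𝓕⁻ ψ : 𝓢(EuclideanSpace ℝ (Fin n), EuclideanSpace ℂ (Fin N))) p volume :=
      fun ψ => Lp.enorm_toLp ((𝓕⁻ ψ).memLp p volume)
    simp only [Function.comp_def, h2, hg, FourierTransform.fourierInv_fourier_eq] at h1
    refine h1.congr fun k => ?_
    rw [SchwartzMap.fourierInv_coe, coe_compactSchwartz (hc k) (hs k)]
  refine (Lp.eLpNorm_lim_le_liminf_eLpNorm (fun k =>
    (continuous_fourierInv_of_integrable (hint k)).aestronglyMeasurable) _
    (ae_of_all _ hpt)).trans ?_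
  refine (liminf_le_liminf (Eventually.of_forall fun k => hm (h k) (hc k) (hs k))).trans ?_
  exact (ENNReal.Tendsto.const_mul hnorm (Or.inr ENNReal.ofReal_ne_top)).liminf_eq.le

theorem HasCompactFourierBound.isLpFourierMultiplier (hp : p ≠ ⊤) (hp1 : 1 ≤ p) (hC : 0 < C)
    (hms : IsSmoothSymbol m) (hm : HasCompactFourierBound p (dilatedSymbol m) C) :
    IsLpFourierMultiplier p m where
  memLp_top := hm.memLp_top hp hp1 hC.le hms
  memLp_op φ := by
    have : Fact (1 ≤ p) := ⟨hp1⟩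
    refine ⟨(continuous_fourierInv_of_integrable (integrable_symbol_mul_fourier
      (hm.memLp_top hp hp1 hC.le hms) φ)).aestronglyMeasurable,
      (hm.eLpNorm_opSchwartz_le hp hp1 hC.le hms φ).trans_lt ?_⟩
    exact ENNReal.mul_lt_top ENNReal.ofReal_lt_top (φ.memLp p volume).2
  bound := ⟨C, hC, hm.eLpNorm_opSchwartz_le hp hp1 hC.le hms⟩

theorem HasCompactFourierBound.multiplierNorm_le [Fact (1 ≤ p)] (hp : p ≠ ⊤) (hC : 0 ≤ C)
    (hms : IsSmoothSymbol m) (hm : HasCompactFourierBound p (dilatedSymbol m) C)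
    (h : IsLpFourierMultiplier p m) : h.multiplierNorm ≤ C := by
  have hd : DenseRange (SchwartzMap.toLpCLM ℂ (EuclideanSpace ℂ (Fin N)) p
      (volume : Measure (EuclideanSpace ℝ (Fin n)))).toLinearMap :=
    SchwartzMap.denseRange_toLpCLM (F := EuclideanSpace ℂ (Fin N)) hp
  refine LinearMap.opNorm_extendOfNorm_le hd hC fun φ => ?_
  have h1 : ‖h.opLinear φ‖ = (eLpNorm (opSchwartz m φ) p volume).toReal :=
    Lp.norm_toLp _ (h.memLp_op φ)
  have h2 : ‖(SchwartzMap.toLpCLM ℂ (EuclideanSpace ℂ (Fin N)) p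
      (volume : Measure (EuclideanSpace ℝ (Fin n)))).toLinearMap φ‖ =
      (eLpNorm φ p volume).toReal := SchwartzMap.norm_toLp
  rw [h1, h2]
  have h3 := ENNReal.toReal_mono
    (ENNReal.mul_ne_top ENNReal.ofReal_ne_top (φ.memLp p volume).2.ne)
    (hm.eLpNorm_opSchwartz_le hp Fact.out hC hms φ)
  rwa [ENNReal.toReal_mul, ENNReal.toReal_ofReal hC] at h3

theorem enorm_ofFourier [Fact (1 ≤ p)]
    {h : EuclideanSpace ℝ (Fin n) → EuclideanSpace ℂ (Fin N)} (hc : HasCompactSupport h)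
    (hs : ContDiff ℝ ∞ h) : ‖ofFourier p h‖ₑ = eLpNorm (𝓕⁻ h) p volume := by
  rw [Lp.enorm_def]
  exact eLpNorm_congr_ae (ofFourier_ae_eq hc hs)

/-- Data with smooth compactly supported Fourier transform `h` lie in the domain, and their solution
must be `𝓕⁻(e^{ta} h)`; the a priori estimate is then the claimed bound. -/
theorem IsWellPosed.exists_hasCompactFourierBound [Fact (1 ≤ p)]
    (ha : ∀ i j, (fun ξ => dilatedSymbol a ξ i j).HasTemperateGrowth)
    (hwp : IsWellPosed (maximalRealization p a)) {T : ℝ} (hT : 0 < T) :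
    ∃ C : ℝ, 0 < C ∧ ∀ t ∈ Set.Icc (0 : ℝ) T,
      HasCompactFourierBound p (dilatedSymbol (expSymbol a t)) C := by
  obtain ⟨C, hC, hbound⟩ := hwp.bound T hT
  refine ⟨C, hC, fun t ht h hc hs => ?_⟩
  have hb : IsSmoothSymbol (expSymbol (dilatedSymbol a) t) :=
    IsSmoothSymbol.expSymbol (fun i j => (ha i j).1) t
  have hdom := ofFourier_mem_domain (p := p) ha hc hs
  obtain ⟨u, hu⟩ := hwp.exists_solution _ hdom
  have h1 : u t = ofFourier p (applySymbol (expSymbol (dilatedSymbol a) t) h) :=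
    (hu.isFourierRelated ha ht.1).unique (isFourierRelated_ofFourier hc hs hb)
  have h2 := hbound _ hdom u hu t ht
  rw [h1] at h2
  rw [dilatedSymbol_expSymbol, ← enorm_ofFourier hc hs,
    ← enorm_ofFourier hc.applySymbol (hb.applySymbol hs), ← ofReal_norm, ← ofReal_norm,
    ← ENNReal.ofReal_mul hC.le]
  exact ENNReal.ofReal_le_ofReal h2

/-- Locally uniform bounds of the multiplier norms of `e^{ta}` give a `C₀`-semigroup. -/
theorem semigroup_of_multiplierNorm_le [Fact (1 ≤ p)] (hp : p ≠ ⊤)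
    (ha : ∀ i j, (fun ξ => dilatedSymbol a ξ i j).HasTemperateGrowth)
    (hbdd : ∀ T : ℝ, 0 < T → ∃ C : ℝ, 0 < C ∧ ∀ t ∈ Set.Icc (0 : ℝ) T,
      ∃ hm : IsLpFourierMultiplier p (expSymbol a t), hm.multiplierNorm ≤ C) :
    IsWellPosed (maximalRealization p a) ∧
      ∃ hm : ∀ t : ℝ≥0, IsLpFourierMultiplier p (expSymbol a t),
        IsC0Semigroup (fun t => (hm t).op) ∧
        IsGeneratorOf (maximalRealization p a) (fun t => (hm t).op) := by
  have hb : IsSmoothSymbol (dilatedSymbol a) := fun i j => (ha i j).1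
  have hm : ∀ t : ℝ≥0, IsLpFourierMultiplier p (expSymbol a t) := fun t => by
    -- The shift by `1` gives an interval of positive length also for `t = 0`.
    obtain ⟨C, -, hC⟩ := hbdd (t + 1) (by positivity)
    exact (hC t ⟨t.2, by simp⟩).1
  have hS : ∀ (t : ℝ≥0) u, IsFourierRelated (expSymbol (dilatedSymbol a) t) u ((hm t).op u) :=
    fun t u => (hm t).isFourierRelated_op hp (hb.expSymbol t) u
  have hS' : ∀ T : ℝ≥0, ∃ C : ℝ, ∀ t ≤ T, ‖(hm t).op‖ ≤ C := fun T => by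
    obtain ⟨C, -, hC⟩ := hbdd (T + 1) (by positivity)
    refine ⟨C, fun t ht => (hC t ⟨t.2, ?_⟩).2⟩
    have : (t : ℝ) ≤ T := ht
    linarith
  have hC0 : IsC0Semigroup fun t => (hm t).op := .of_isFourierRelated hp hb hS hS'
  exact ⟨isWellPosed_maximalRealization hS ha hC0 hS', hm, hC0,
    isGeneratorOf_maximalRealization hS ha hC0⟩

end Multipliers

end

/-! ### Main theorem -/

theorem theorem2p7 {n N : ℕ} (p : ℝ≥0∞) [Fact (1 ≤ p)] (hp : 1 < p) (hp' : p < ⊤)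
    (μ : ℝ) (a : EuclideanSpace ℝ (Fin n) → Matrix (Fin N) (Fin N) ℂ)
    (ha : IsMatrixSymbol μ a) (hqh : IsQuasiHyperbolic a) :
    ((maximalRealization p a).IsClosed ∧
      Dense ((maximalRealization p a).domain : Set (LpSpace n N p))) ∧
    (IsWellPosed (maximalRealization p a) ↔
      ∀ T : ℝ, 0 < T → ∃ C : ℝ, 0 < C ∧ ∀ t ∈ Set.Icc (0 : ℝ) T,
        ∃ hm : IsLpFourierMultiplier p (expSymbol a t), hm.multiplierNorm ≤ C) ∧
    (IsWellPosed (maximalRealization p a) →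
      ∃ hm : ∀ t : ℝ≥0, IsLpFourierMultiplier p (expSymbol a t),
        IsC0Semigroup (fun t => (hm t).op) ∧
        IsGeneratorOf (maximalRealization p a) (fun t => (hm t).op)) := by
  have hb := ha.hasTemperateGrowth_dilatedSymbol
  have hmult : IsWellPosed (maximalRealization p a) →
      ∀ T : ℝ, 0 < T → ∃ C : ℝ, 0 < C ∧ ∀ t ∈ Set.Icc (0 : ℝ) T,
        ∃ hm : IsLpFourierMultiplier p (expSymbol a t), hm.multiplierNorm ≤ C := by
    intro hwp T hT
    obtain ⟨C, hC, hCb⟩ := hwp.exists_hasCompactFourierBound hb hT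
    have hs : ∀ t, IsSmoothSymbol (expSymbol a t) :=
      IsSmoothSymbol.expSymbol fun i j => (ha i j).1
    exact ⟨C, hC, fun t ht => ⟨(hCb t ht).isLpFourierMultiplier hp'.ne hp.le hC (hs t),
      (hCb t ht).multiplierNorm_le hp'.ne hC.le (hs t) _⟩⟩
  exact ⟨⟨isClosed_maximalRealization hb, dense_domain_maximalRealization hp'.ne hb⟩,
    ⟨hmult, fun h => (semigroup_of_multiplierNorm_le hp'.ne hb h).1⟩,
    fun h => (semigroup_of_multiplierNorm_le hp'.ne hb (hmult h)).2⟩
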